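/- **Theorem 3.6 (Implications from Hessian gradient flows).** Let $\mathcal S,\mathcal A$ be finite sets, $P(\cdot\mid s,a)$ a probability vector on $\mathcal S$ for all $(s,a)$, $\gamma\in[0,1)$, $r\in\mathbb R^{\mathcal S\times\mathcal A}$, and $\mu$ a probability vector on $\mathcal S$. A policy is a $\pi\in\Delta_{\mathcal A}^{\mathcal S}$, that is, a family of probability vectors $\pi(\cdot\mid s)$, $s\in\mathcal S$; $\operatorname{int}(\Delta_{\mathcal A}^{\mathcal S})$ is the set of policies with all entries positive. Let $\mathbb P^{\pi}$ be the law of the process $S_0\sim\mu$, $A_t\sim\pi(\cdot\mid S_t)$, $S_{t+1}\sim P(\cdot\mid S_t,A_t)$, and put $$R(\pi)=(1-\gamma)\,\mathbb E_{\mathbb P^\pi}\Big[\sum_{t\ge0}\gamma^t r(S_t,A_t)\Big],\qquad d^\pi(s)=(1-\gamma)\sum_{t\ge0}\gamma^t\,\mathbb P^\pi(S_t=s),\qquad \nu^\pi(s,a)=(1-\gamma)\sum_{t\ge0}\gamma^t\,\mathbb P^\pi(S_t=s,A_t=a),$$ $$D_{\mathrm K}(\pi_1,\pi_2)=\sum_{s}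 d^{\pi_1}(s)\sum_a\pi_1(a\mid s)\log\frac{\pi_1(a\mid s)}{\pi_2(a\mid s)},\qquad R^\star=\max_{\pi}R(\pi),\qquad \Pi^\star=\{\pi: R(\pi)=R^\star\}.$$ Assume that $d^\pi(s)>0$ for all $\pi\in\operatorname{int}(\Delta_{\mathcal A}^{\mathcal S})$ and $s\in\mathcal S$, and let $\pi_0\in\operatorname{int}(\Delta_{\mathcal A}^{\mathcal S})$. Let $\nabla^{\mathrm K}R$ be the Riemannian gradient of $R$ on $\operatorname{int}(\Delta_{\mathcal A}^{\mathcal S})$ with respect to the Kakade metric $$g^{\mathrm K}_\pi(w_1,w_2)=\sum_s d^\pi(s)\sum_a\frac{w_1(s,a)w_2(s,a)}{\pi(a\mid s)},\qquad w_i\in\mathbb R^{\mathcal S\times\mathcal A},\ \sum_a w_i(s,a)=0\text{ for all }s.$$ 1. *(Well-posedness)* The Kakade gradient flow $\partial_t\pi_t=\nabla^{\mathrm K}R(\pi_t)$ with initial value $\pi_0$ has a unique global solution $(\pi_t)_{t\ge0}$ in $\operatorname{int}(\Delta_{\mathcal A}^{\mathcal S})$, and every solution on an interval $[0,T)$, $T>0$,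 with initial value $\pi_0$ agrees with it there. 2. *(Central path property)* For all $t>0$, $\pi_t$ is the unique maximizer over $\Delta_{\mathcal A}^{\mathcal S}$ of $\pi\mapsto R(\pi)-t^{-1}D_{\mathrm K}(\pi,\pi_0)$; for $t=0$, $\pi_0$ is the unique minimizer over $\Delta_{\mathcal A}^{\mathcal S}$ of $\pi\mapsto D_{\mathrm K}(\pi,\pi_0)$. 3. *(Sublinear convergence)* The maximum $R^\star$ and the minimum $\min_{\pi^\star\in\Pi^\star}D_{\mathrm K}(\pi^\star,\pi_0)$ are attained, $R^\star-R(\pi_t)\ge0$ for all $t\ge0$, and for all $t>0$ $$R^\star-R(\pi_t)\le\frac{\min_{\pi^\star\in\Pi^\star}D_{\mathrm K}(\pi^\star,\pi_0)-D_{\mathrm K}(\pi_t,\pi_0)}{t}\le\frac{\min_{\pi^\star\in\Pi^\star}D_{\mathrm K}(\pi^\star,\pi_0)}{t}.$$ 4. *(Implicit bias)* The limit $\pi^\star=\lim_{t\to+\infty}\pi_t$ exists and $$\pi^\star\in\operatorname*{argmin}_{\pi\in\Pi^\star}D_{\mathrm K}(\pi,\pi_0).$$ This set of minimizers consists exactly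 of the policies $\pi$ with $\nu^\pi=\nu^{\pi^\star}$, and every $\pi$ in it satisfies $\pi(\cdot\mid s)=\pi^\star(\cdot\mid s)$ for all $s$ with $d^{\pi^\star}(s)>0$. In particular, if $d^{\pi^\star}(s)>0$ for all $s\in\mathcal S$ (for instance if $\mu(s)>0$ for all $s$), then $\pi^\star$ is the unique minimizer. -/

import Mathlib

open MeasureTheory ProbabilityTheory Filter Topology

/-- A finite discounted Markov decision process `(S, A, P, γ, r)` with an initial distribution `μ`.
`P s a s'` is the probability `P(s' | s, a)`, and `stdSimplex ℝ S` is the probability simplex over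
`S`. -/
structure FiniteMDP (S A : Type*) [Fintype S] [Fintype A] where
  P : S → A → S → ℝ
  P_mem : ∀ s a, P s a ∈ stdSimplex ℝ S
  μ : S → ℝ
  μ_mem : μ ∈ stdSimplex ℝ S
  γ : ℝ
  γ_nonneg : 0 ≤ γ
  γ_lt_one : γ < 1
  r : S → A → ℝ

/-- The polytope of policies: `π s a` is the probability `π(a | s)`, every `π s` is a probability
vector. -/
def policies (S A : Type*) [Fintype A] : Set (S → A → ℝ) :=
  {π | ∀ s, π s ∈ stdSimplex ℝ A}

/-- The (relative) interior of the policy polytope: the policies with positive entries. -/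
def interiorPolicies (S A : Type*) [Fintype A] : Set (S → A → ℝ) :=
  {π | π ∈ policies S A ∧ ∀ s a, 0 < π s a}

/-- The tangent space of the policy polytope: the directions whose rows sum to zero. -/
def policyTangent (S A : Type*) [Fintype A] : Set (S → A → ℝ) :=
  {w | ∀ s, ∑ a, w s a = 0}

/-- The Kullback-Leibler divergence of two vectors (with `0 log 0 = 0`; it is only used for a
second argument with positive entries). -/
noncomputable def vecKL {A : Type*} [Fintype A] (p q : A → ℝ) : ℝ :=
  ∑ a, p a * Real.log (p a / q a)

/-- A probability vector, seen as a probability mass function. -/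
noncomputable def simplexPMF {X : Type*} [Fintype X] (p : X → ℝ) (hp : p ∈ stdSimplex ℝ X) :
    PMF X :=
  PMF.ofFintype (fun x => ENNReal.ofReal (p x)) (by
    rw [← ENNReal.ofReal_sum_of_nonneg (fun x _ => hp.1 x), hp.2, ENNReal.ofReal_one])

namespace FiniteMDP

variable {S A : Type*} [Fintype S] [Fintype A]

/-- The law of `(s, a)` when `s` has law `p` and `a` is then drawn from `π(· | s)`. -/
noncomputable def drawAction (π : S → A → ℝ) (hπ : π ∈ policies S A) (p : PMF S) : PMF (S × A) :=
  p.bind fun s => (simplexPMF (π s) (hπ s)).map fun a => (s, a)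

variable [MeasurableSpace S] [MeasurableSingletonClass S]
  [MeasurableSpace A] [MeasurableSingletonClass A]

/-- The transition kernel of the state-action process: given the history up to time `n`, draw
`S_{n+1} ∼ P(· | S_n, A_n)` and then `A_{n+1} ∼ π(· | S_{n+1})`. -/
noncomputable def stepKernel (M : FiniteMDP S A) (π : S → A → ℝ) (hπ : π ∈ policies S A) (n : ℕ) :
    Kernel ((i : Finset.Iic n) → (fun _ : ℕ => S × A) i) (S × A) :=
  Kernel.ofFunOfCountable fun h =>
    (drawAction π hπ
      (simplexPMF (M.P (h ⟨n, by simp⟩).1 (h ⟨n, by simp⟩).2) (M.P_mem _ _))).toMeasure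

instance (M : FiniteMDP S A) (π : S → A → ℝ) (hπ : π ∈ policies S A) (n : ℕ) :
    IsMarkovKernel (M.stepKernel π hπ n) :=
  ⟨fun _ => PMF.toMeasure.isProbabilityMeasure _⟩

open Classical in
/-- The law on trajectories `(S_t, A_t)_{t ∈ ℕ}` of the process `S_0 ∼ μ`, `A_t ∼ π(· | S_t)`,
`S_{t+1} ∼ P(· | S_t, A_t)` (and `0` by convention if `π` is not a policy). -/
noncomputable def pathLaw (M : FiniteMDP S A) (π : S → A → ℝ) : Measure (ℕ → S × A) :=
  if hπ : π ∈ policies S A then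
    Kernel.trajMeasure (X := fun _ => S × A)
      (drawAction π hπ (simplexPMF M.μ M.μ_mem)).toMeasure (M.stepKernel π hπ)
  else 0

/-- The discounted infinite-horizon reward `R(π) = (1 - γ) 𝔼[∑ₜ γᵗ r(S_t, A_t)]`. -/
noncomputable def reward (M : FiniteMDP S A) (π : S → A → ℝ) : ℝ :=
  (1 - M.γ) * ∫ ω, ∑' t : ℕ, M.γ ^ t * M.r (ω t).1 (ω t).2 ∂(M.pathLaw π)

/-- The discounted state distribution `d^π(s) = (1 - γ) ∑ₜ γᵗ ℙ(S_t = s)`. -/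
noncomputable def stateDist (M : FiniteMDP S A) (π : S → A → ℝ) (s : S) : ℝ :=
  (1 - M.γ) * ∑' t : ℕ, M.γ ^ t * (M.pathLaw π).real {ω | (ω t).1 = s}

/-- The discounted state-action distribution `ν^π(s, a) = (1 - γ) ∑ₜ γᵗ ℙ(S_t = s, A_t = a)`. -/
noncomputable def stateActionDist (M : FiniteMDP S A) (π : S → A → ℝ) (s : S) (a : A) : ℝ :=
  (1 - M.γ) * ∑' t : ℕ, M.γ ^ t * (M.pathLaw π).real {ω | (ω t).1 = s ∧ (ω t).2 = a}

/-- The Kakade divergence `D_K(π₁, π₂) = ∑ₛ d^{π₁}(s) D_KL(π₁(· | s), π₂(· | s))`. -/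
noncomputable def kakadeDiv (M : FiniteMDP S A) (π₁ π₂ : S → A → ℝ) : ℝ :=
  ∑ s, M.stateDist π₁ s * vecKL (π₁ s) (π₂ s)

/-- State exploration: every interior policy reaches every state. -/
def Exploration (M : FiniteMDP S A) : Prop :=
  ∀ π ∈ interiorPolicies S A, ∀ s, 0 < M.stateDist π s

/-- The optimal reward `R⋆ = max_π R(π)`. -/
noncomputable def optReward (M : FiniteMDP S A) : ℝ :=
  sSup (M.reward '' policies S A)

/-- The set `Π⋆` of optimal policies. -/
def optPolicies (M : FiniteMDP S A) : Set (S → A → ℝ) :=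
  {π | π ∈ policies S A ∧ M.reward π = M.optReward}

/-- The set of Kakade projections of `π₀` onto the set of optimal policies, that is, the set of
minimizers of `D_K(·, π₀)` over `Π⋆`. -/
def kakadeProjections (M : FiniteMDP S A) (π₀ : S → A → ℝ) : Set (S → A → ℝ) :=
  {π | π ∈ M.optPolicies ∧ IsMinOn (fun ρ => M.kakadeDiv ρ π₀) M.optPolicies π}

/-- The smallest Kakade divergence to `π₀` of an optimal policy. -/
noncomputable def minKakadeDiv (M : FiniteMDP S A) (π₀ : S → A → ℝ) : ℝ :=
  sInf ((fun ρ => M.kakadeDiv ρ π₀) '' M.optPolicies)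

/-- The Kakade metric at the policy `π`. -/
noncomputable def kakadeMetric (M : FiniteMDP S A) (π w₁ w₂ : S → A → ℝ) : ℝ :=
  ∑ s, M.stateDist π s * ∑ a, w₁ s a * w₂ s a / π s a

/-- `G` is the Riemannian gradient at `π` of the function `f` on the policy polytope with respect
to the Kakade metric: `f` is differentiable at `π` along the polytope, `G` is a tangent vector, and
`g_π(G, w) = df(π) w` for every tangent vector `w`. -/
def IsKakadeGradient (M : FiniteMDP S A) (f : (S → A → ℝ) → ℝ) (π G : S → A → ℝ) : Prop :=
  G ∈ policyTangent S A ∧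
    ∃ L : (S → A → ℝ) →L[ℝ] ℝ, HasFDerivWithinAt f L (policies S A) π ∧
      ∀ w ∈ policyTangent S A, M.kakadeMetric π G w = L w

/-- The curve `p` solves the Kakade gradient flow `∂ₜ πₜ = ∇ᴷ R(πₜ)` in the interior of the policy
polytope on the time interval `J` (with the one-sided derivative at an endpoint that belongs to
`J`). -/
def IsKakadeFlowOn (M : FiniteMDP S A) (J : Set ℝ) (p : ℝ → S → A → ℝ) : Prop :=
  ∀ t ∈ J, p t ∈ interiorPolicies S A ∧
    ∃ G : S → A → ℝ, M.IsKakadeGradient M.reward (p t) G ∧ HasDerivWithinAt p G J t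

end FiniteMDP

/-!
The flow can be solved explicitly. For a reference policy `π₀` let `W t` be the fixed point of the
soft Bellman operator
`W ↦ (s ↦ log ∑ₐ π₀(a | s) exp (t r(s, a) + γ ∑ₛ' P(s' | s, a) W(s')))`,
which is a `γ`-contraction in the sup norm for every real `t`, and let
`π_t(a | s) = π₀(a | s) exp (t r(s, a) + γ ∑ₛ' P(s' | s, a) W t s' - W t s)` (`softPolicy`).

*Flow.* By the policy gradient theorem (`exists_hasFDerivWithinAt_reward`, a consequence of the
performance difference lemma and of the continuity of `d^π`) the Kakade gradient of the reward is
`π (Q^π - V^π)` (`isKakadeGradient_reward_iff`). The contraction property shows that `W` is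
differentiable and that its derivative at `t` is the value function of `π_t`
(`hasDerivAt_softValue`), so that `π_t` solves the flow. Conversely, along any solution `q` the
derivative of `log (q / π₀)` is `r + γ P V - V` for a function `V` of the state. Integration
gives `q` the form of `π_t` for some function of the state, and the normalization of `q` leaves
`W t` as the only choice (`IsKakadeFlowOn.eqOn_softPolicy`).

*Central path.* For every policy `π` the three-point identity (`reward_sub_kakadeDiv`)
`t R(π) - D(π, π₀) = (1 - γ) ∑ₛ μ(s) W t s - D(π, π_t)` holds, because `∑ₛ d^π(s) f(s)` can be
computed from the balance equation of `d^π`. The divergence `D(π, π_t)` dominates a squared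
Hellinger distance, hence vanishes only if `π = π_t`.

*Convergence.* For a Kakade projection `π` the identity reads
`min D = t (R⋆ - R(π_t)) + D(π_t, π₀) + D(π, π_t)` with nonnegative summands
(`minKakadeDiv_eq_add`). This is the sublinear rate; it also shows that cluster points of `π_t` as
`t → ∞` are Kakade projections and that then `D(π, π_t) → 0` along the cluster, so that `π` agrees
with the cluster point in all states with `d^π(s) > 0` (`mem_kakadeProjections_of_tendsto`). If
`d^π` is positive everywhere, there is only one cluster point. In general the limit still exists,
since `π_t` does not depend on `μ`, and `μ` may be replaced by the uniform distribution
(`exists_tendsto_softPolicy`).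
-/

/-! ### The state-action process and its discounted occupancies -/

namespace FiniteMDP

variable {S A : Type*} [Fintype S] [Fintype A]

theorem simplexPMF_apply {X : Type*} [Fintype X] (p : X → ℝ) (hp : p ∈ stdSimplex ℝ X) (x : X) :
    simplexPMF p hp x = ENNReal.ofReal (p x) := rfl

omit [Fintype S] in
theorem drawAction_apply (π : S → A → ℝ) (hπ : π ∈ policies S A) (p : PMF S) (s : S) (a : A) :
    drawAction π hπ p (s, a) = p s * ENNReal.ofReal (π s a) := by
  classical
  rw [drawAction, PMF.bind_apply, tsum_eq_single s]
  · rw [PMF.map_apply, tsum_eq_single a]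
    · simp [simplexPMF_apply]
    · intro b hb
      simp [Ne.symm hb]
  · intro s' hs'
    rw [PMF.map_apply, ENNReal.tsum_eq_zero.2, mul_zero]
    intro b
    simp [Ne.symm hs']

variable [MeasurableSpace S] [MeasurableSingletonClass S]
  [MeasurableSpace A] [MeasurableSingletonClass A]

theorem drawAction_toMeasure_real (π : S → A → ℝ) (hπ : π ∈ policies S A) (q : S → ℝ)
    (hq : q ∈ stdSimplex ℝ S) (x : S × A) :
    (drawAction π hπ (simplexPMF q hq)).toMeasure.real {x} = q x.1 * π x.1 x.2 := by
  rw [measureReal_def, PMF.toMeasure_apply_singleton _ _ (measurableSet_singleton x),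
    drawAction_apply, simplexPMF_apply, ← ENNReal.ofReal_mul (hq.1 _),
    ENNReal.toReal_ofReal (mul_nonneg (hq.1 _) ((hπ _).1 _))]

theorem isProbabilityMeasure_pathLaw (M : FiniteMDP S A) {π : S → A → ℝ} (hπ : π ∈ policies S A) :
    IsProbabilityMeasure (M.pathLaw π) := by
  rw [pathLaw, dif_pos hπ]
  infer_instance

theorem pathLaw_real_zero (M : FiniteMDP S A) {π : S → A → ℝ} (hπ : π ∈ policies S A) (x : S × A) :
    (M.pathLaw π).real {ω | ω 0 = x} = M.μ x.1 * π x.1 x.2 := by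
  have key : (M.pathLaw π).map (fun ω => ω 0) =
      (drawAction π hπ (simplexPMF M.μ M.μ_mem)).toMeasure := by
    have h0 : (fun ω : ℕ → S × A => ω 0) =
        (MeasurableEquiv.piUnique (fun _ : Finset.Iic 0 => S × A)) ∘
          Preorder.frestrictLe (π := fun _ => S × A) 0 := rfl
    rw [pathLaw, dif_pos hπ, h0, ← Measure.map_map (by fun_prop) (by fun_prop),
      Kernel.trajMeasure, Measure.map_comp _ _ (by fun_prop), Kernel.traj_map_frestrictLe,
      Kernel.partialTraj_self, Measure.id_comp, Measure.map_map (by fun_prop) (by fun_prop),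
      MeasurableEquiv.self_comp_symm, Measure.map_id]
  rw [← drawAction_toMeasure_real π hπ M.μ M.μ_mem x, ← key,
    map_measureReal_apply (by fun_prop) (measurableSet_singleton x)]
  rfl

theorem pathLaw_real_succ (M : FiniteMDP S A) {π : S → A → ℝ} (hπ : π ∈ policies S A) (n : ℕ)
    (x : S × A) :
    (M.pathLaw π).real {ω | ω (n + 1) = x} =
      (∑ y : S × A, (M.pathLaw π).real {ω | ω n = y} * M.P y.1 y.2 x.1) * π x.1 x.2 := by
  have := M.isProbabilityMeasure_pathLaw hπ
  have key := Kernel.map_frestrictLe_trajMeasure_compProd_eq_map_trajMeasure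
    (X := fun _ => S × A) (κ := M.stepKernel π hπ) (a := n)
    (μ₀ := (drawAction π hπ (simplexPMF M.μ M.μ_mem)).toMeasure)
  have hpath : M.pathLaw π = Kernel.trajMeasure (X := fun _ => S × A)
      (drawAction π hπ (simplexPMF M.μ M.μ_mem)).toMeasure (M.stepKernel π hπ) := by
    rw [pathLaw, dif_pos hπ]
  rw [← hpath] at key
  have h1 : (M.pathLaw π) {ω | ω (n + 1) = x} =
      ∑ y : S × A, (M.pathLaw π) {ω | ω n = y} *
        (drawAction π hπ (simplexPMF (M.P y.1 y.2) (M.P_mem _ _))).toMeasure {x} := by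
    have hset : {ω : ℕ → S × A | ω (n + 1) = x} =
        (fun ω => (Preorder.frestrictLe (π := fun _ => S × A) n ω, ω (n + 1))) ⁻¹'
          (Set.univ ×ˢ {x}) := by
      ext ω; simp
    have hmeas : MeasurableSet
        ((Set.univ : Set ((i : Finset.Iic n) → S × A)) ×ˢ ({x} : Set (S × A))) :=
      MeasurableSet.univ.prod (measurableSet_singleton x)
    rw [hset, ← Measure.map_apply (by fun_prop) hmeas, ← key,
      Measure.compProd_apply_prod MeasurableSet.univ (measurableSet_singleton x),
      Measure.restrict_univ, lintegral_map (Kernel.measurable_coe _ (measurableSet_singleton x))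
        (by fun_prop)]
    change ∫⁻ ω, (fun y : S × A => (drawAction π hπ
      (simplexPMF (M.P y.1 y.2) (M.P_mem _ _))).toMeasure {x}) (ω n) ∂(M.pathLaw π) = _
    rw [← lintegral_map (f := fun y : S × A => (drawAction π hπ
      (simplexPMF (M.P y.1 y.2) (M.P_mem _ _))).toMeasure {x}) (g := fun ω : ℕ → S × A => ω n)
      (Measurable.of_discrete) (by fun_prop), lintegral_fintype]
    refine Finset.sum_congr rfl fun y _ => ?_
    rw [mul_comm, Measure.map_apply (by fun_prop) (measurableSet_singleton y)]
    rfl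
  rw [measureReal_def, h1, ENNReal.toReal_sum (fun y _ => ENNReal.mul_ne_top
    (measure_ne_top _ _) (measure_ne_top _ _)), Finset.sum_mul]
  refine Finset.sum_congr rfl fun y _ => ?_
  rw [ENNReal.toReal_mul, ← measureReal_def, ← measureReal_def,
    drawAction_toMeasure_real π hπ _ (M.P_mem _ _) x, mul_assoc]

theorem pathLaw_real_state (M : FiniteMDP S A) {π : S → A → ℝ} (hπ : π ∈ policies S A) (n : ℕ)
    (s : S) :
    (M.pathLaw π).real {ω | (ω n).1 = s} = ∑ a, (M.pathLaw π).real {ω | ω n = (s, a)} := by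
  have := M.isProbabilityMeasure_pathLaw hπ
  have hset : {ω : ℕ → S × A | (ω n).1 = s} = ⋃ a ∈ Finset.univ, {ω | ω n = (s, a)} := by
    ext ω
    simp [Prod.ext_iff]
  rw [hset, measureReal_biUnion_finset]
  · intro a _ b _ hab
    rw [Function.onFun, Set.disjoint_left]
    intro ω h1 h2
    exact hab (Prod.ext_iff.1 (h1.symm.trans h2)).2
  · intro a _
    exact measurableSet_eq_fun (measurable_pi_apply n) measurable_const

/-- The action at every time is drawn from the policy. -/
theorem pathLaw_real_eq (M : FiniteMDP S A) {π : S → A → ℝ} (hπ : π ∈ policies S A) (n : ℕ)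
    (s : S) (a : A) :
    (M.pathLaw π).real {ω | ω n = (s, a)} = (M.pathLaw π).real {ω | (ω n).1 = s} * π s a := by
  rw [pathLaw_real_state M hπ]
  cases n with
  | zero =>
    simp only [pathLaw_real_zero M hπ]
    rw [← Finset.mul_sum, (hπ s).2, mul_one]
  | succ n =>
    simp only [pathLaw_real_succ M hπ]
    rw [← Finset.mul_sum, (hπ s).2, mul_one]

theorem pathLaw_real_state_zero (M : FiniteMDP S A) {π : S → A → ℝ} (hπ : π ∈ policies S A)
    (s : S) : (M.pathLaw π).real {ω | (ω 0).1 = s} = M.μ s := by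
  simp only [pathLaw_real_state M hπ, pathLaw_real_zero M hπ]
  rw [← Finset.mul_sum, (hπ s).2, mul_one]

theorem pathLaw_real_state_succ (M : FiniteMDP S A) {π : S → A → ℝ} (hπ : π ∈ policies S A)
    (n : ℕ) (s : S) :
    (M.pathLaw π).real {ω | (ω (n + 1)).1 = s} =
      ∑ s', (M.pathLaw π).real {ω | (ω n).1 = s'} * ∑ a, π s' a * M.P s' a s := by
  rw [pathLaw_real_state M hπ]
  simp only [pathLaw_real_succ M hπ]
  rw [← Finset.mul_sum, (hπ s).2, mul_one, Fintype.sum_prod_type]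
  refine Finset.sum_congr rfl fun s' _ => ?_
  rw [Finset.mul_sum]
  refine Finset.sum_congr rfl fun a _ => ?_
  rw [pathLaw_real_eq M hπ, mul_assoc]

theorem summable_discount (M : FiniteMDP S A) {π : S → A → ℝ} (hπ : π ∈ policies S A)
    (E : ℕ → Set (ℕ → S × A)) : Summable fun t => M.γ ^ t * (M.pathLaw π).real (E t) := by
  have := M.isProbabilityMeasure_pathLaw hπ
  refine (summable_geometric_of_lt_one M.γ_nonneg M.γ_lt_one).of_nonneg_of_le
    (fun t => mul_nonneg (pow_nonneg M.γ_nonneg t) measureReal_nonneg) fun t => ?_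
  exact mul_le_of_le_one_right (pow_nonneg M.γ_nonneg t) measureReal_le_one

theorem stateActionDist_eq (M : FiniteMDP S A) {π : S → A → ℝ} (hπ : π ∈ policies S A)
    (s : S) (a : A) : M.stateActionDist π s a = M.stateDist π s * π s a := by
  rw [stateActionDist, stateDist, mul_assoc, ← tsum_mul_right]
  congr 2
  ext t
  have : {ω : ℕ → S × A | (ω t).1 = s ∧ (ω t).2 = a} = {ω | ω t = (s, a)} := by
    ext ω; simp [Prod.ext_iff]
  rw [this, pathLaw_real_eq M hπ, mul_assoc]

theorem stateDist_nonneg (M : FiniteMDP S A) (π : S → A → ℝ) (s : S) : 0 ≤ M.stateDist π s :=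
  mul_nonneg (sub_nonneg.2 M.γ_lt_one.le)
    (tsum_nonneg fun t => mul_nonneg (pow_nonneg M.γ_nonneg t) measureReal_nonneg)

/-- The flow balance (Bellman flow) equation of the discounted state distribution. -/
theorem stateDist_balance (M : FiniteMDP S A) {π : S → A → ℝ} (hπ : π ∈ policies S A) (s : S) :
    M.stateDist π s =
      (1 - M.γ) * M.μ s + M.γ * ∑ s', M.stateDist π s' * ∑ a, π s' a * M.P s' a s := by
  have hs := fun s' : S => M.summable_discount hπ (fun t => {ω | (ω t).1 = s'})
  rw [stateDist, (hs s).tsum_eq_zero_add, pow_zero, one_mul, pathLaw_real_state_zero M hπ, mul_add]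
  congr 1
  simp only [stateDist, pathLaw_real_state_succ M hπ, mul_assoc]
  rw [← Finset.mul_sum, mul_left_comm M.γ]
  congr 1
  simp only [← tsum_mul_right]
  rw [← Summable.tsum_finsetSum (fun s' _ => (hs s').mul_right _), ← tsum_mul_left]
  refine tsum_congr fun t => ?_
  rw [pow_succ', mul_assoc, Finset.mul_sum]
  simp only [mul_assoc]

/-- The reward is linear in the discounted state-action distribution. -/
theorem reward_eq (M : FiniteMDP S A) {π : S → A → ℝ} (hπ : π ∈ policies S A) :
    M.reward π = ∑ s, M.stateDist π s * ∑ a, π s a * M.r s a := by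
  classical
  have := M.isProbabilityMeasure_pathLaw hπ
  obtain ⟨C, hC⟩ : ∃ C, ∀ x : S × A, |M.r x.1 x.2| ≤ C := by
    obtain ⟨C, hC⟩ := (Set.finite_range fun x : S × A => |M.r x.1 x.2|).bddAbove
    exact ⟨C, fun x => hC ⟨x, rfl⟩⟩
  have hmeas : ∀ t : ℕ, Measurable fun ω : ℕ → S × A => M.γ ^ t * M.r (ω t).1 (ω t).2 := fun t =>
    (Measurable.of_discrete (f := fun x : S × A => M.γ ^ t * M.r x.1 x.2)).comp
      (measurable_pi_apply t)
  have hbound : ∀ t (ω : ℕ → S × A), ‖M.γ ^ t * M.r (ω t).1 (ω t).2‖ ≤ M.γ ^ t * C := by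
    intro t ω
    rw [norm_mul, Real.norm_eq_abs, Real.norm_eq_abs, abs_of_nonneg (pow_nonneg M.γ_nonneg t)]
    exact mul_le_mul_of_nonneg_left (hC (ω t)) (pow_nonneg M.γ_nonneg t)
  have hint : ∀ t : ℕ, Integrable (fun ω : ℕ → S × A => M.γ ^ t * M.r (ω t).1 (ω t).2)
      (M.pathLaw π) := fun t =>
    Integrable.of_bound (hmeas t).aestronglyMeasurable _ (ae_of_all _ (hbound t))
  have hgeo : Summable fun t : ℕ => M.γ ^ t * C :=
    (summable_geometric_of_lt_one M.γ_nonneg M.γ_lt_one).mul_right C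
  have hswap : ∫ ω, ∑' t : ℕ, M.γ ^ t * M.r (ω t).1 (ω t).2 ∂(M.pathLaw π) =
      ∑' t : ℕ, ∫ ω, M.γ ^ t * M.r (ω t).1 (ω t).2 ∂(M.pathLaw π) := by
    refine (integral_tsum_of_summable_integral_norm hint ?_).symm
    refine hgeo.of_nonneg_of_le (fun t => integral_nonneg fun ω => norm_nonneg _) fun t => ?_
    calc ∫ ω, ‖M.γ ^ t * M.r (ω t).1 (ω t).2‖ ∂(M.pathLaw π)
        ≤ ∫ _ω, M.γ ^ t * C ∂(M.pathLaw π) :=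
          integral_mono (hint t).norm (integrable_const _) (hbound t)
      _ = M.γ ^ t * C := by simp
  have hone : ∀ t : ℕ, ∫ ω, M.γ ^ t * M.r (ω t).1 (ω t).2 ∂(M.pathLaw π) =
      ∑ s, M.γ ^ t * (M.pathLaw π).real {ω | (ω t).1 = s} * ∑ a, π s a * M.r s a := by
    intro t
    rw [integral_const_mul]
    have h1 : ∫ ω, M.r (ω t).1 (ω t).2 ∂(M.pathLaw π) =
        ∫ x : S × A, M.r x.1 x.2 ∂((M.pathLaw π).map fun ω => ω t) := by
      rw [integral_map (measurable_pi_apply t).aemeasurable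
        (Measurable.of_discrete).aestronglyMeasurable]
    have : IsProbabilityMeasure ((M.pathLaw π).map fun ω : ℕ → S × A => ω t) :=
      Measure.isProbabilityMeasure_map (measurable_pi_apply t).aemeasurable
    rw [h1, integral_fintype Integrable.of_finite, Fintype.sum_prod_type, Finset.mul_sum]
    refine Finset.sum_congr rfl fun s _ => ?_
    rw [mul_assoc]
    congr 1
    rw [Finset.mul_sum]
    refine Finset.sum_congr rfl fun a _ => ?_
    rw [map_measureReal_apply (by fun_prop) (measurableSet_singleton _), smul_eq_mul, ← mul_assoc,
      ← pathLaw_real_eq M hπ]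
    rfl
  rw [reward, hswap, tsum_congr hone, Summable.tsum_finsetSum
    (fun s _ => (M.summable_discount hπ (fun t => {ω | (ω t).1 = s})).mul_right _), Finset.mul_sum]
  refine Finset.sum_congr rfl fun s _ => ?_
  rw [tsum_mul_right, stateDist, mul_assoc]

end FiniteMDP

/-! ### The policy polytope -/

theorem policies_eq_pi (S A : Type*) [Fintype A] :
    policies S A = Set.univ.pi fun _ : S => stdSimplex ℝ A := by
  ext π
  simp [policies]

theorem isCompact_policies (S A : Type*) [Fintype A] : IsCompact (policies S A) := by
  rw [policies_eq_pi]
  exact isCompact_univ_pi fun _ => isCompact_stdSimplex ℝ A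

/-- At an interior policy every tangent vector is a feasible direction. -/
theorem mem_tangentConeAt_policies {S A : Type*} [Fintype S] [Fintype A] {π w : S → A → ℝ}
    (hπ : π ∈ interiorPolicies S A) (hw : w ∈ policyTangent S A) :
    w ∈ tangentConeAt ℝ (policies S A) π := by
  have hev : ∀ᶠ ε : ℝ in 𝓝[>] 0, ∀ s a, 0 < π s a + ε * w s a := by
    refine eventually_all.2 fun s => eventually_all.2 fun a => ?_
    refine (Tendsto.mono_left ?_ nhdsWithin_le_nhds).eventually_const_lt (hπ.2 s a)
    exact Continuous.tendsto' (by fun_prop) _ _ (by simp)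
  refine mem_tangentConeAt_of_add_smul_mem (tendsto_id'.mpr (nhdsGT_le_nhdsNE 0)) ?_
  filter_upwards [hev] with ε hε s
  refine ⟨fun a => (hε s a).le, ?_⟩
  have : ∑ a, (π + ε • w) s a = ∑ a, π s a + ε * ∑ a, w s a := by
    simp [Finset.sum_add_distrib, Finset.mul_sum]
  exact this.trans (by rw [(hπ.1 s).2, hw s, mul_zero, add_zero])

namespace FiniteMDP

variable {S A : Type*} [Fintype S] [Fintype A]

/-! ### One-step look-ahead values -/

/-- The expectation `∑ₛ' P(s' | s, a) f(s')` of `f` at the successor state. -/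
noncomputable def nextValue (M : FiniteMDP S A) (f : S → ℝ) (s : S) (a : A) : ℝ :=
  ∑ s', M.P s a s' * f s'

/-- The state-action value `r(s, a) + γ ∑ₛ' P(s' | s, a) V(s')` obtained by one-step look-ahead
from the state value `V`. -/
noncomputable def qValue (M : FiniteMDP S A) (V : S → ℝ) (s : S) (a : A) : ℝ :=
  M.r s a + M.γ * M.nextValue V s a

theorem nextValue_mono (M : FiniteMDP S A) {f g : S → ℝ} (h : f ≤ g) (s : S) (a : A) :
    M.nextValue f s a ≤ M.nextValue g s a :=
  Finset.sum_le_sum fun s' _ => mul_le_mul_of_nonneg_left (h s') ((M.P_mem s a).1 s')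

theorem nextValue_add_const (M : FiniteMDP S A) (f : S → ℝ) (c : ℝ) (s : S) (a : A) :
    M.nextValue (fun x => f x + c) s a = M.nextValue f s a + c := by
  simp only [nextValue, mul_add, Finset.sum_add_distrib, ← Finset.sum_mul, (M.P_mem s a).2, one_mul]

/-- Blackwell's criterion: a monotone operator that turns the addition of a constant `c` into the
addition of `K c` is a contraction in the sup norm. -/
theorem contractingWith_of_monotone {ι : Type*} [Fintype ι] {T : (ι → ℝ) → ι → ℝ} {K : NNReal}
    (hK : K < 1) (hmono : Monotone T) (hconst : ∀ f c i, T (fun x => f x + c) i = T f i + K * c) :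
    ContractingWith K T := by
  refine ⟨hK, LipschitzWith.of_dist_le_mul fun f g => ?_⟩
  have key : ∀ f g : ι → ℝ, ∀ i, T f i - T g i ≤ K * dist f g := by
    intro f g i
    have h1 : f ≤ fun x => g x + dist f g := fun x => by
      have := (le_abs_self _).trans ((Real.dist_eq _ _).symm.le.trans (dist_le_pi_dist f g x))
      linarith
    have h2 := hmono h1 i
    rw [hconst] at h2
    linarith
  refine (dist_pi_le_iff (by positivity)).2 fun i => ?_
  rw [Real.dist_eq, abs_sub_le_iff]
  exact ⟨key f g i, dist_comm f g ▸ key g f i⟩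

/-- The discount factor as a nonnegative real. -/
noncomputable def discount (M : FiniteMDP S A) : NNReal := ⟨M.γ, M.γ_nonneg⟩

theorem discount_lt_one (M : FiniteMDP S A) : M.discount < 1 := M.γ_lt_one

/-- `V` is the (unnormalized) value function of the policy `π`: it solves the Bellman equation. -/
def IsPolicyValue (M : FiniteMDP S A) (π : S → A → ℝ) (V : S → ℝ) : Prop :=
  ∀ s, ∑ a, π s a * M.qValue V s a = V s

theorem exists_isPolicyValue (M : FiniteMDP S A) {π : S → A → ℝ} (hπ : π ∈ policies S A) :
    ∃ V, M.IsPolicyValue π V := by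
  have hT : ContractingWith M.discount fun V s => ∑ a, π s a * M.qValue V s a := by
    refine contractingWith_of_monotone M.discount_lt_one (fun f g hfg s => ?_) fun f c s => ?_
    · refine Finset.sum_le_sum fun a _ => mul_le_mul_of_nonneg_left ?_ ((hπ s).1 a)
      have := mul_le_mul_of_nonneg_left (M.nextValue_mono hfg s a) M.γ_nonneg
      simpa [qValue] using this
    · have : ∀ a, π s a * M.qValue (fun x => f x + c) s a =
          π s a * M.qValue f s a + π s a * (M.γ * c) := fun a => by
        rw [qValue, nextValue_add_const, qValue]; ring
      simp only [this, Finset.sum_add_distrib, ← Finset.sum_mul, (hπ s).2, one_mul]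
      rfl
  exact ⟨hT.fixedPoint, fun s => congrFun hT.fixedPoint_isFixedPt s⟩

variable [MeasurableSpace S] [MeasurableSingletonClass S]
  [MeasurableSpace A] [MeasurableSingletonClass A]

/-! ### The balance equation determines the state distribution -/

/-- The balance equation tested against a function of the state. -/
theorem sum_stateDist_mul (M : FiniteMDP S A) {π : S → A → ℝ} (hπ : π ∈ policies S A)
    (f : S → ℝ) :
    ∑ s, M.stateDist π s * f s = (1 - M.γ) * ∑ s, M.μ s * f s +
      M.γ * ∑ s, M.stateDist π s * ∑ a, π s a * M.nextValue f s a := by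
  have h1 : ∀ s, M.stateDist π s * f s = (1 - M.γ) * (M.μ s * f s) +
      M.γ * ∑ s', M.stateDist π s' * ∑ a, π s' a * (M.P s' a s * f s) := fun s => by
    conv_lhs => rw [M.stateDist_balance hπ s]
    simp only [add_mul, mul_assoc, Finset.sum_mul]
  simp only [h1]
  rw [Finset.sum_add_distrib, ← Finset.mul_sum, ← Finset.mul_sum, Finset.sum_comm]
  congr 2
  refine Finset.sum_congr rfl fun s _ => ?_
  rw [← Finset.mul_sum, Finset.sum_comm]
  simp only [nextValue, Finset.mul_sum]

omit [MeasurableSpace S] [MeasurableSingletonClass S] [MeasurableSpace A]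
  [MeasurableSingletonClass A] in
/-- Stability of the balance equation in the `ℓ¹` norm, under a change of the policy. With
`π = π'` this is the uniqueness of its solution. -/
theorem sum_abs_sub_le_of_balance (M : FiniteMDP S A) {π π' : S → A → ℝ} (hπ : π ∈ policies S A)
    {x y : S → ℝ}
    (hx : ∀ s, x s = (1 - M.γ) * M.μ s + M.γ * ∑ s', x s' * ∑ a, π s' a * M.P s' a s)
    (hy : ∀ s, y s = (1 - M.γ) * M.μ s + M.γ * ∑ s', y s' * ∑ a, π' s' a * M.P s' a s) :
    (1 - M.γ) * ∑ s, |x s - y s| ≤ M.γ * ∑ s, |y s| * ∑ a, |π s a - π' s a| := by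
  have hcol : ∀ (c : S → A → ℝ), (∑ s, ∑ s', ∑ a, c s' a * M.P s' a s) = ∑ s, ∑ a, c s a := by
    intro c
    rw [Finset.sum_comm]
    refine Finset.sum_congr rfl fun s _ => ?_
    rw [Finset.sum_comm]
    simp only [← Finset.mul_sum, (M.P_mem _ _).2, mul_one]
  have h1 : ∀ s, |x s - y s| ≤ M.γ * ∑ s', ∑ a,
      (|x s' - y s'| * π s' a + |y s'| * |π s' a - π' s' a|) * M.P s' a s := by
    intro s
    have : x s - y s = M.γ * ∑ s', ∑ a,
        ((x s' - y s') * π s' a + y s' * (π s' a - π' s' a)) * M.P s' a s := by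
      conv_lhs => rw [hx s, hy s]
      rw [add_sub_add_left_eq_sub, ← mul_sub, ← Finset.sum_sub_distrib]
      congr 1
      refine Finset.sum_congr rfl fun s' _ => ?_
      rw [Finset.mul_sum, Finset.mul_sum, ← Finset.sum_sub_distrib]
      exact Finset.sum_congr rfl fun a _ => by ring
    rw [this, abs_mul, abs_of_nonneg M.γ_nonneg]
    refine mul_le_mul_of_nonneg_left ((Finset.abs_sum_le_sum_abs _ _).trans
      (Finset.sum_le_sum fun s' _ => (Finset.abs_sum_le_sum_abs _ _).trans
      (Finset.sum_le_sum fun a _ => ?_))) M.γ_nonneg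
    rw [abs_mul, abs_of_nonneg ((M.P_mem s' a).1 s)]
    refine mul_le_mul_of_nonneg_right ((abs_add_le _ _).trans ?_) ((M.P_mem s' a).1 s)
    rw [abs_mul, abs_mul, abs_of_nonneg ((hπ s').1 a)]
  have h2 := Finset.sum_le_sum fun s (_ : s ∈ Finset.univ) => h1 s
  rw [← Finset.mul_sum, hcol] at h2
  simp only [Finset.sum_add_distrib, ← Finset.mul_sum, (hπ _).2, mul_one] at h2
  linarith

theorem eq_stateDist_of_balance (M : FiniteMDP S A) {π : S → A → ℝ} (hπ : π ∈ policies S A)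
    {x : S → ℝ}
    (hx : ∀ s, x s = (1 - M.γ) * M.μ s + M.γ * ∑ s', x s' * ∑ a, π s' a * M.P s' a s) :
    x = M.stateDist π := by
  have h := M.sum_abs_sub_le_of_balance hπ hx (M.stateDist_balance hπ)
  simp only [sub_self, abs_zero, Finset.sum_const_zero, mul_zero] at h
  have h0 : ∑ s, |x s - M.stateDist π s| ≤ 0 :=
    nonpos_of_mul_nonpos_right h (sub_pos.2 M.γ_lt_one)
  have h1 := (Finset.sum_eq_zero_iff_of_nonneg fun s _ => abs_nonneg _).1
    (h0.antisymm (Finset.sum_nonneg fun s _ => abs_nonneg _))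
  exact funext fun s => sub_eq_zero.1 (abs_eq_zero.1 (h1 s (Finset.mem_univ s)))

/-- Two policies that agree in all states visited by the first one have the same state
distribution. -/
theorem stateDist_eq_of_eq (M : FiniteMDP S A) {π π' : S → A → ℝ} (hπ : π ∈ policies S A)
    (hπ' : π' ∈ policies S A) (h : ∀ s, 0 < M.stateDist π s → π s = π' s) :
    M.stateDist π = M.stateDist π' := by
  refine M.eq_stateDist_of_balance hπ' fun s => ?_
  conv_lhs => rw [M.stateDist_balance hπ s]
  congr 2
  refine Finset.sum_congr rfl fun s' _ => ?_
  rcases (M.stateDist_nonneg π s').eq_or_lt with h0 | h0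
  · simp [← h0]
  · rw [h s' h0]

theorem continuousOn_stateDist (M : FiniteMDP S A) (s : S) :
    ContinuousOn (fun π => M.stateDist π s) (policies S A) := by
  intro π hπ
  have hγ : 0 < 1 - M.γ := sub_pos.2 M.γ_lt_one
  have hbound : ∀ π' ∈ policies S A, |M.stateDist π' s - M.stateDist π s| ≤
      (1 - M.γ)⁻¹ * (M.γ * ∑ s, |M.stateDist π s| * ∑ a, |π' s a - π s a|) := by
    intro π' hπ'
    rw [← div_eq_inv_mul, le_div_iff₀' hγ]
    refine le_trans ?_
      (M.sum_abs_sub_le_of_balance hπ' (M.stateDist_balance hπ') (M.stateDist_balance hπ))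
    exact mul_le_mul_of_nonneg_left (Finset.single_le_sum
      (f := fun s => |M.stateDist π' s - M.stateDist π s|) (fun _ _ => abs_nonneg _)
      (Finset.mem_univ s)) hγ.le
  rw [ContinuousWithinAt, tendsto_iff_dist_tendsto_zero]
  refine squeeze_zero' (Eventually.of_forall fun _ => dist_nonneg)
    (eventually_nhdsWithin_of_forall fun π' hπ' => hbound π' hπ') ?_
  refine Tendsto.mono_left (Continuous.tendsto' ?_ _ _ (by simp)) nhdsWithin_le_nhds
  fun_prop

/-! ### Policy gradients -/

theorem continuousOn_reward (M : FiniteMDP S A) : ContinuousOn M.reward (policies S A) := by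
  have h : ContinuousOn (fun π => ∑ s, M.stateDist π s * ∑ a, π s a * M.r s a) (policies S A) :=
    continuousOn_finsetSum _ fun s _ => (M.continuousOn_stateDist s).mul
      (Continuous.continuousOn (by fun_prop))
  exact h.congr fun π hπ => M.reward_eq hπ

/-- The performance difference lemma. -/
theorem reward_sub_reward (M : FiniteMDP S A) {π π' : S → A → ℝ} (hπ : π ∈ policies S A)
    (hπ' : π' ∈ policies S A) {V : S → ℝ} (hV : M.IsPolicyValue π V) :
    M.reward π' - M.reward π =
      ∑ s, ∑ a, M.stateDist π' s * M.qValue V s a * (π' s a - π s a) := by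
  have key : ∀ ρ ∈ policies S A, M.reward ρ = (1 - M.γ) * ∑ s, M.μ s * V s +
      ∑ s, ∑ a, M.stateDist ρ s * M.qValue V s a * (ρ s a - π s a) := by
    intro ρ hρ
    have h1 := M.sum_stateDist_mul hρ V
    have h2 : ∑ s, M.stateDist ρ s * ∑ a, ρ s a * M.qValue V s a = M.reward ρ +
        M.γ * ∑ s, M.stateDist ρ s * ∑ a, ρ s a * M.nextValue V s a := by
      rw [M.reward_eq hρ, Finset.mul_sum, ← Finset.sum_add_distrib]
      refine Finset.sum_congr rfl fun s _ => ?_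
      rw [mul_left_comm, ← mul_add, Finset.mul_sum (f := fun a => ρ s a * M.nextValue V s a),
        ← Finset.sum_add_distrib]
      congr 1
      refine Finset.sum_congr rfl fun a _ => ?_
      rw [qValue]; ring
    have h3 : ∑ s, ∑ a, M.stateDist ρ s * M.qValue V s a * (ρ s a - π s a) =
        ∑ s, M.stateDist ρ s * ∑ a, ρ s a * M.qValue V s a - ∑ s, M.stateDist ρ s * V s := by
      rw [← Finset.sum_sub_distrib]
      refine Finset.sum_congr rfl fun s _ => ?_
      rw [← hV s, ← mul_sub, ← Finset.sum_sub_distrib, Finset.mul_sum]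
      exact Finset.sum_congr rfl fun a _ => by ring
    linarith
  rw [key π' hπ', key π hπ]
  simp

/-- The policy gradient theorem, with the derivative taken along the polytope of policies. -/
theorem exists_hasFDerivWithinAt_reward (M : FiniteMDP S A) {π : S → A → ℝ} (hπ : π ∈ policies S A)
    {V : S → ℝ} (hV : M.IsPolicyValue π V) :
    ∃ L : (S → A → ℝ) →L[ℝ] ℝ, HasFDerivWithinAt M.reward L (policies S A) π ∧
      ∀ w, L w = ∑ s, ∑ a, M.stateDist π s * M.qValue V s a * w s a := by
  let L : (S → A → ℝ) →L[ℝ] ℝ := ∑ s, ∑ a, (M.stateDist π s * M.qValue V s a) •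
    (ContinuousLinearMap.proj (R := ℝ) (φ := fun _ : A => ℝ) a).comp
      (ContinuousLinearMap.proj (R := ℝ) (φ := fun _ : S => A → ℝ) s)
  have hL : ∀ w, L w = ∑ s, ∑ a, M.stateDist π s * M.qValue V s a * w s a := fun w => by
    simp [L]
  refine ⟨L, HasFDerivWithinAt.of_isLittleO ?_, hL⟩
  -- The remainder is the sum of the products of the increments of `d^π` and of `π`.
  have hrem : (fun π' => ∑ s, ∑ a, (M.stateDist π' s - M.stateDist π s) * M.qValue V s a *
      (π' s a - π s a)) =o[𝓝[policies S A] π] fun π' => π' - π := by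
    refine Asymptotics.IsLittleO.fun_sum fun s _ => Asymptotics.IsLittleO.fun_sum fun a _ => ?_
    have h1 : (fun π' => (M.stateDist π' s - M.stateDist π s) * M.qValue V s a)
        =o[𝓝[policies S A] π] fun _ => (1 : ℝ) := by
      rw [Asymptotics.isLittleO_one_iff]
      have := ((M.continuousOn_stateDist s π hπ).tendsto.sub_const
        (M.stateDist π s)).mul_const (M.qValue V s a)
      simpa using this
    have h2 : (fun π' : S → A → ℝ => π' s a - π s a) =O[𝓝[policies S A] π] fun π' => π' - π :=
      (Asymptotics.IsBigO.of_norm_le (g := fun π' : S → A → ℝ => ‖π' - π‖) fun π' =>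
        (norm_le_pi_norm ((π' - π) s) a).trans (norm_le_pi_norm (π' - π) s)).of_norm_right
    simpa using h1.mul_isBigO h2.norm_right
  refine hrem.congr' (eventually_nhdsWithin_of_forall fun π' hπ' => ?_) EventuallyEq.rfl
  change _ = M.reward π' - M.reward π - L (π' - π)
  rw [M.reward_sub_reward hπ hπ' hV, hL, ← Finset.sum_sub_distrib]
  refine Finset.sum_congr rfl fun s _ => ?_
  rw [← Finset.sum_sub_distrib]
  refine Finset.sum_congr rfl fun a _ => ?_
  simp only [Pi.sub_apply]
  ring

/-- The Kakade gradient of the reward is the natural policy gradient `π (Q^π - V^π)`. -/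
theorem isKakadeGradient_reward_iff (M : FiniteMDP S A) (hM : M.Exploration) {π : S → A → ℝ}
    (hπ : π ∈ interiorPolicies S A) {V : S → ℝ} (hV : M.IsPolicyValue π V) (G : S → A → ℝ) :
    M.IsKakadeGradient M.reward π G ↔ G = fun s a => π s a * (M.qValue V s a - V s) := by
  obtain ⟨L, hL, hLw⟩ := M.exists_hasFDerivWithinAt_reward hπ.1 hV
  have htan : (fun s a => π s a * (M.qValue V s a - V s)) ∈ policyTangent S A := fun s => by
    simp only [mul_sub, Finset.sum_sub_distrib, ← Finset.sum_mul, (hπ.1 s).2, hV s]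
    ring
  have hmet : ∀ w ∈ policyTangent S A,
      M.kakadeMetric π (fun s a => π s a * (M.qValue V s a - V s)) w = L w := by
    intro w hw
    rw [hLw, kakadeMetric]
    refine Finset.sum_congr rfl fun s _ => ?_
    have h1 : ∀ a, π s a * (M.qValue V s a - V s) * w s a / π s a =
        M.qValue V s a * w s a - V s * w s a := fun a => by
      have := (hπ.2 s a).ne'
      field_simp
    simp only [h1, Finset.sum_sub_distrib, ← Finset.mul_sum, hw s, mul_zero, sub_zero]
    rw [Finset.mul_sum]
    exact Finset.sum_congr rfl fun a _ => (mul_assoc _ _ _).symm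
  refine ⟨fun ⟨hG, L', hL', hGL'⟩ => ?_, fun h => h ▸ ⟨htan, L, hL, hmet⟩⟩
  -- Both gradients represent the same differential, and the metric is positive definite.
  set G₀ : S → A → ℝ := fun s a => π s a * (M.qValue V s a - V s) with hG₀
  have hw : G - G₀ ∈ policyTangent S A := fun s => by
    simp only [Pi.sub_apply, Finset.sum_sub_distrib, hG s, htan s, sub_self]
  have h0 : M.kakadeMetric π (G - G₀) (G - G₀) = 0 := by
    have h1 : M.kakadeMetric π (G - G₀) (G - G₀) =
        M.kakadeMetric π G (G - G₀) - M.kakadeMetric π G₀ (G - G₀) := by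
      simp only [kakadeMetric, ← Finset.sum_sub_distrib, ← mul_sub]
      refine Finset.sum_congr rfl fun s _ => congrArg _ (Finset.sum_congr rfl fun a _ => ?_)
      simp only [Pi.sub_apply]
      ring
    rw [h1, hGL' _ hw, hmet _ hw,
      hL'.unique_on hL (mem_tangentConeAt_policies hπ hw), sub_self]
  have hnn : ∀ s a, 0 ≤ (G - G₀) s a * (G - G₀) s a / π s a := fun s a =>
    div_nonneg (mul_self_nonneg _) (hπ.2 s a).le
  have h2 := (Finset.sum_eq_zero_iff_of_nonneg fun s _ => mul_nonneg (M.stateDist_nonneg π s)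
    (Finset.sum_nonneg fun a _ => hnn s a)).1 h0
  funext s a
  have h3 := (mul_eq_zero.1 (h2 s (Finset.mem_univ s))).resolve_left (hM π hπ s).ne'
  have h4 := (Finset.sum_eq_zero_iff_of_nonneg fun a _ => hnn s a).1 h3 a (Finset.mem_univ a)
  have h5 := (div_eq_zero_iff.1 h4).resolve_right (hπ.2 s a).ne'
  exact sub_eq_zero.1 (mul_self_eq_zero.1 h5)

end FiniteMDP

namespace FiniteMDP

variable {S A : Type*} [Fintype S] [Fintype A]

/-! ### Soft values and the central path -/

/-- The soft Bellman operator with reference policy `π₀` at inverse temperature `t`, acting on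
values that are multiplied by `t`:
`W ↦ (s ↦ log ∑ₐ π₀(a | s) exp (t r(s, a) + γ ∑ₛ' P(s' | s, a) W(s')))`. The multiplication by `t`
makes it meaningful, and smooth, at `t = 0` too. -/
noncomputable def softBellman (M : FiniteMDP S A) (π₀ : S → A → ℝ) (t : ℝ) (W : S → ℝ) (s : S) :
    ℝ :=
  Real.log (∑ a, π₀ s a * Real.exp (t * M.r s a + M.γ * M.nextValue W s a))

theorem softBellman_sum_pos (M : FiniteMDP S A) {π₀ : S → A → ℝ} (hπ₀ : π₀ ∈ policies S A)
    (t : ℝ) (W : S → ℝ) (s : S) :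
    0 < ∑ a, π₀ s a * Real.exp (t * M.r s a + M.γ * M.nextValue W s a) := by
  have hnn : ∀ a ∈ Finset.univ,
      0 ≤ π₀ s a * Real.exp (t * M.r s a + M.γ * M.nextValue W s a) := fun a _ =>
    mul_nonneg ((hπ₀ s).1 a) (Real.exp_pos _).le
  refine (Finset.sum_nonneg hnn).lt_of_ne fun h0 => ?_
  have h1 : ∀ a, π₀ s a = 0 := fun a =>
    (mul_eq_zero.1 ((Finset.sum_eq_zero_iff_of_nonneg hnn).1 h0.symm a (Finset.mem_univ a))
      ).resolve_right (Real.exp_pos _).ne'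
  have h2 := (hπ₀ s).2
  simp [h1] at h2

theorem contractingWith_softBellman (M : FiniteMDP S A) {π₀ : S → A → ℝ}
    (hπ₀ : π₀ ∈ policies S A) (t : ℝ) : ContractingWith M.discount (M.softBellman π₀ t) := by
  refine contractingWith_of_monotone M.discount_lt_one (fun f g hfg s => ?_) fun f c s => ?_
  · refine Real.log_le_log (M.softBellman_sum_pos hπ₀ t f s)
      (Finset.sum_le_sum fun a _ => mul_le_mul_of_nonneg_left ?_ ((hπ₀ s).1 a))
    have := mul_le_mul_of_nonneg_left (M.nextValue_mono hfg s a) M.γ_nonneg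
    exact Real.exp_le_exp.2 (by linarith)
  · have h1 : ∀ a, π₀ s a * Real.exp (t * M.r s a + M.γ * M.nextValue (fun x => f x + c) s a) =
        π₀ s a * Real.exp (t * M.r s a + M.γ * M.nextValue f s a) * Real.exp (M.γ * c) := by
      intro a
      rw [nextValue_add_const, mul_assoc, ← Real.exp_add]
      ring_nf
    simp only [softBellman, h1, ← Finset.sum_mul]
    rw [Real.log_mul (M.softBellman_sum_pos hπ₀ t f s).ne' (Real.exp_pos _).ne', Real.log_exp]
    rfl

/-- The soft value function (times `t`) at inverse temperature `t`. It does not depend on the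
initial distribution. -/
noncomputable def softValue (M : FiniteMDP S A) {π₀ : S → A → ℝ} (hπ₀ : π₀ ∈ policies S A) (t : ℝ) :
    S → ℝ :=
  (M.contractingWith_softBellman hπ₀ t).fixedPoint

/-- The softmax policy `π₀(a | s) exp (t r(s, a) + γ ∑ₛ' P(s' | s, a) W(s') - W(s))` of a function
`W` of the state. -/
noncomputable def tiltedPolicy (M : FiniteMDP S A) (π₀ : S → A → ℝ) (t : ℝ) (W : S → ℝ) :
    S → A → ℝ :=
  fun s a => π₀ s a * Real.exp (t * M.r s a + M.γ * M.nextValue W s a - W s)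

/-- The central path: the softmax policies of the soft values. -/
noncomputable def softPolicy (M : FiniteMDP S A) {π₀ : S → A → ℝ} (hπ₀ : π₀ ∈ policies S A)
    (t : ℝ) : S → A → ℝ :=
  M.tiltedPolicy π₀ t (M.softValue hπ₀ t)

theorem sum_tiltedPolicy (M : FiniteMDP S A) (π₀ : S → A → ℝ) (t : ℝ) (W : S → ℝ) (s : S) :
    ∑ a, M.tiltedPolicy π₀ t W s a =
      (∑ a, π₀ s a * Real.exp (t * M.r s a + M.γ * M.nextValue W s a)) / Real.exp (W s) := by
  rw [Finset.sum_div]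
  exact Finset.sum_congr rfl fun a _ => by rw [tiltedPolicy, Real.exp_sub, mul_div_assoc]

theorem softBellman_softValue (M : FiniteMDP S A) {π₀ : S → A → ℝ} (hπ₀ : π₀ ∈ policies S A)
    (t : ℝ) : M.softBellman π₀ t (M.softValue hπ₀ t) = M.softValue hπ₀ t :=
  (M.contractingWith_softBellman hπ₀ t).fixedPoint_isFixedPt

theorem exp_softValue (M : FiniteMDP S A) {π₀ : S → A → ℝ} (hπ₀ : π₀ ∈ policies S A)
    (t : ℝ) (s : S) : Real.exp (M.softValue hπ₀ t s) =
      ∑ a, π₀ s a * Real.exp (t * M.r s a + M.γ * M.nextValue (M.softValue hπ₀ t) s a) := by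
  conv_lhs => rw [← M.softBellman_softValue hπ₀ t]
  exact Real.exp_log (M.softBellman_sum_pos hπ₀ t _ s)

/-- A softmax policy is normalized only if it comes from the soft value. -/
theorem eq_softValue_of_sum_tiltedPolicy (M : FiniteMDP S A) {π₀ : S → A → ℝ}
    (hπ₀ : π₀ ∈ policies S A) {t : ℝ} {W : S → ℝ}
    (h : ∀ s, ∑ a, M.tiltedPolicy π₀ t W s a = 1) : W = M.softValue hπ₀ t := by
  refine (M.contractingWith_softBellman hπ₀ t).fixedPoint_unique (funext fun s => ?_)
  have h1 := h s
  rw [sum_tiltedPolicy, div_eq_one_iff_eq (Real.exp_pos _).ne'] at h1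
  rw [softBellman, h1, Real.log_exp]

theorem softPolicy_mem (M : FiniteMDP S A) {π₀ : S → A → ℝ} (hπ₀ : π₀ ∈ interiorPolicies S A)
    (t : ℝ) : M.softPolicy hπ₀.1 t ∈ interiorPolicies S A := by
  have hpos : ∀ s a, 0 < M.softPolicy hπ₀.1 t s a := fun s a =>
    mul_pos (hπ₀.2 s a) (Real.exp_pos _)
  refine ⟨fun s => ⟨fun a => (hpos s a).le, ?_⟩, hpos⟩
  rw [softPolicy, sum_tiltedPolicy, ← exp_softValue, div_self (Real.exp_pos _).ne']

theorem softPolicy_zero (M : FiniteMDP S A) {π₀ : S → A → ℝ} (hπ₀ : π₀ ∈ policies S A) :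
    M.softPolicy hπ₀ 0 = π₀ := by
  have h0 : ∀ s a, M.tiltedPolicy π₀ 0 0 s a = π₀ s a := fun s a => by
    simp [tiltedPolicy, nextValue]
  have h : (0 : S → ℝ) = M.softValue hπ₀ 0 :=
    M.eq_softValue_of_sum_tiltedPolicy hπ₀ fun s => by simp only [h0, (hπ₀ s).2]
  funext s a
  rw [softPolicy, ← h, h0]

/-! ### The central path solves the Kakade gradient flow -/

theorem hasDerivWithinAt_nextValue (M : FiniteMDP S A) {W : ℝ → S → ℝ} {V : S → ℝ} {J : Set ℝ}
    {t : ℝ} (hW : HasDerivWithinAt W V J t) (s : S) (a : A) :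
    HasDerivWithinAt (fun u => M.nextValue (W u) s a) (M.nextValue V s a) J t :=
  HasDerivWithinAt.fun_sum fun s' _ => ((hasDerivWithinAt_pi.1 hW) s').const_mul _

/-- The `t`-derivative of the soft value is the value function of the softmax policy. -/
theorem hasDerivAt_softValue (M : FiniteMDP S A) {π₀ : S → A → ℝ} (hπ₀ : π₀ ∈ policies S A)
    {t : ℝ} {V : S → ℝ} (hV : M.IsPolicyValue (M.softPolicy hπ₀ t) V) :
    HasDerivAt (M.softValue hπ₀) V t := by
  set W := M.softValue hπ₀ with hWdef
  -- The tangent line `U` is a fixed point of the soft Bellman operators up to an error `o(u - t)`,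
  -- and the contraction property turns this into the distance to the true fixed point.
  let U : ℝ → S → ℝ := fun u => W t + (u - t) • V
  have hU : HasDerivAt U V t := by
    simpa [U] using (((hasDerivAt_id t).sub_const t).smul_const V).const_add (W t)
  have hF : HasDerivAt (fun u => M.softBellman π₀ u (U u)) V t := by
    refine hasDerivAt_pi.2 fun s => ?_
    have hexp : ∀ a, HasDerivAt
        (fun u => π₀ s a * Real.exp (u * M.r s a + M.γ * M.nextValue (U u) s a))
        (π₀ s a * (Real.exp (t * M.r s a + M.γ * M.nextValue (U t) s a) * M.qValue V s a)) t := by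
      intro a
      have h1 := hasDerivWithinAt_univ.1 (M.hasDerivWithinAt_nextValue
        (J := Set.univ) (hasDerivWithinAt_univ.2 hU) s a)
      have h2 := ((hasDerivAt_id t).mul_const (M.r s a)).add (h1.const_mul M.γ)
      simp only [one_mul] at h2
      exact h2.exp.const_mul _
    have hlog := (HasDerivAt.fun_sum fun a (_ : a ∈ Finset.univ) => hexp a).log
      (M.softBellman_sum_pos hπ₀ t (U t) s).ne'
    refine hlog.congr_deriv ?_
    have hUt : U t = W t := by simp [U]
    rw [hUt, ← M.exp_softValue hπ₀, ← hV s, Finset.sum_div]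
    refine Finset.sum_congr rfl fun a _ => ?_
    rw [softPolicy, tiltedPolicy, Real.exp_sub]
    ring
  have hFt : M.softBellman π₀ t (U t) = U t := by
    simp only [U, sub_self, zero_smul, add_zero]
    exact M.softBellman_softValue hπ₀ t
  have hd := (hU.sub hF)
  rw [hasDerivAt_iff_isLittleO] at hd ⊢
  have hb : (fun u => W u - W t - (u - t) • V) =O[𝓝 t]
      fun u => U u - M.softBellman π₀ u (U u) := by
    refine Asymptotics.IsBigO.of_bound (1 - M.γ)⁻¹ (Eventually.of_forall fun u => ?_)
    have h := (M.contractingWith_softBellman hπ₀ u).dist_fixedPoint_le (U u)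
    rw [dist_comm, dist_eq_norm, dist_eq_norm, div_eq_inv_mul] at h
    rw [sub_sub]
    exact h
  refine hb.trans_isLittleO (hd.congr_left fun u => ?_)
  simp [hFt]

theorem hasDerivAt_softPolicy (M : FiniteMDP S A) {π₀ : S → A → ℝ} (hπ₀ : π₀ ∈ policies S A)
    {t : ℝ} {V : S → ℝ} (hV : M.IsPolicyValue (M.softPolicy hπ₀ t) V) :
    HasDerivAt (M.softPolicy hπ₀)
      (fun s a => M.softPolicy hπ₀ t s a * (M.qValue V s a - V s)) t := by
  have hW := M.hasDerivAt_softValue hπ₀ hV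
  refine hasDerivAt_pi.2 fun s => hasDerivAt_pi.2 fun a => ?_
  have h1 := hasDerivWithinAt_univ.1 (M.hasDerivWithinAt_nextValue
    (J := Set.univ) (hasDerivWithinAt_univ.2 hW) s a)
  have h2 := (((hasDerivAt_id t).mul_const (M.r s a)).add (h1.const_mul M.γ)).sub
    (hasDerivAt_pi.1 hW s)
  simp only [one_mul] at h2
  refine (h2.exp.const_mul (π₀ s a)).congr_deriv ?_
  rw [← mul_assoc]
  rfl

/-- The operator `U ↦ U - γ P_π U` on functions of the state has a left inverse. -/
theorem exists_linearMap_resolvent (M : FiniteMDP S A) {π : S → A → ℝ} (hπ : π ∈ policies S A) :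
    ∃ B : (S → ℝ) →L[ℝ] (S → ℝ),
      ∀ U, B (fun s => U s - M.γ * ∑ a, π s a * M.nextValue U s a) = U := by
  let N : (S → ℝ) →ₗ[ℝ] (S → ℝ) :=
    { toFun := fun U s => U s - M.γ * ∑ a, π s a * M.nextValue U s a
      map_add' := fun U U' => by
        funext s
        simp only [nextValue, Pi.add_apply, mul_add, Finset.sum_add_distrib]
        ring
      map_smul' := fun c U => by
        funext s
        simp only [nextValue, Pi.smul_apply, smul_eq_mul, RingHom.id_apply, mul_sub,
          Finset.mul_sum]
        congr 1
        refine Finset.sum_congr rfl fun a _ => Finset.sum_congr rfl fun s' _ => by ring }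
  have hinj : Function.Injective N := by
    rw [← LinearMap.ker_eq_bot, LinearMap.ker_eq_bot']
    intro U hU
    -- A kernel element is a fixed point of the contraction `γ P_π`, as is `0`.
    have hT : ContractingWith M.discount fun U s => M.γ * ∑ a, π s a * M.nextValue U s a := by
      refine contractingWith_of_monotone M.discount_lt_one (fun f g hfg s => ?_) fun f c s => ?_
      · exact mul_le_mul_of_nonneg_left (Finset.sum_le_sum fun a _ =>
          mul_le_mul_of_nonneg_left (M.nextValue_mono hfg s a) ((hπ s).1 a)) M.γ_nonneg
      · simp only [nextValue_add_const, mul_add, Finset.sum_add_distrib, ← Finset.sum_mul,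
          (hπ s).2, one_mul]
        rfl
    refine hT.fixedPoint_unique' (funext fun s => (sub_eq_zero.1 (congrFun hU s)).symm)
      (funext fun s => by simp [nextValue])
  let e := LinearEquiv.ofInjectiveEndo N hinj
  exact ⟨LinearMap.toContinuousLinearMap e.symm.toLinearMap, fun U => e.symm_apply_apply U⟩

variable [MeasurableSpace S] [MeasurableSingletonClass S]
  [MeasurableSpace A] [MeasurableSingletonClass A]

theorem isKakadeFlowOn_softPolicy (M : FiniteMDP S A) (hM : M.Exploration) {π₀ : S → A → ℝ}
    (hπ₀ : π₀ ∈ interiorPolicies S A) (J : Set ℝ) :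
    M.IsKakadeFlowOn J (M.softPolicy hπ₀.1) := by
  intro t _
  have hmem := M.softPolicy_mem hπ₀ t
  obtain ⟨V, hV⟩ := M.exists_isPolicyValue hmem.1
  exact ⟨hmem, _, (M.isKakadeGradient_reward_iff hM hmem hV _).2 rfl,
    (M.hasDerivAt_softPolicy hπ₀.1 hV).hasDerivWithinAt⟩

/-- Uniqueness of the flow on any interval that starts at `0`. Along a solution, the derivative of
`log (q / π₀)` has the form `r + γ P V - V`, so `log (q / π₀) = t r + γ P W - W` for a function `W`
of the state, and the normalization of `q` forces `W` to be the soft value. -/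
theorem IsKakadeFlowOn.eqOn_softPolicy {M : FiniteMDP S A} (hM : M.Exploration) {π₀ : S → A → ℝ}
    (hπ₀ : π₀ ∈ interiorPolicies S A) {J : Set ℝ} (hJ : Convex ℝ J) (h0 : 0 ∈ J)
    {q : ℝ → S → A → ℝ} (hq : M.IsKakadeFlowOn J q) (hq0 : q 0 = π₀) :
    Set.EqOn q (M.softPolicy hπ₀.1) J := by
  have hV : ∀ t, ∃ V : S → ℝ, t ∈ J → M.IsPolicyValue (q t) V := fun t => by
    by_cases ht : t ∈ J
    · obtain ⟨V, hV⟩ := M.exists_isPolicyValue (hq t ht).1.1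
      exact ⟨V, fun _ => hV⟩
    · exact ⟨0, fun h => absurd h ht⟩
  choose V hV using hV
  let ℓ : ℝ → S → A → ℝ := fun t s a => Real.log (q t s a) - Real.log (π₀ s a)
  have hℓ : ∀ t ∈ J, ∀ s a, HasDerivWithinAt (fun u => ℓ u s a)
      (M.qValue (V t) s a - V t s) J t := by
    intro t ht s a
    obtain ⟨hmem, G, hG, hder⟩ := hq t ht
    rw [M.isKakadeGradient_reward_iff hM hmem (hV t ht)] at hG
    subst hG
    have h1 := hasDerivWithinAt_pi.1 (hasDerivWithinAt_pi.1 hder s) a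
    have h2 := (h1.log (hmem.2 s a).ne').sub_const (Real.log (π₀ s a))
    refine h2.congr_deriv ?_
    rw [mul_div_cancel_left₀ _ (hmem.2 s a).ne']
  obtain ⟨B, hB⟩ := M.exists_linearMap_resolvent hπ₀.1
  -- `W` is recovered from `log (q / π₀) = t r + γ P W - W` by averaging over `π₀`.
  let W : ℝ → S → ℝ := fun t => B fun s => ∑ a, π₀ s a * (t * M.r s a - ℓ t s a)
  have hW : ∀ t ∈ J, HasDerivWithinAt W (V t) J t := by
    intro t ht
    have h1 : HasDerivWithinAt (fun u s => ∑ a, π₀ s a * (u * M.r s a - ℓ u s a))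
        (fun s => V t s - M.γ * ∑ a, π₀ s a * M.nextValue (V t) s a) J t := by
      refine hasDerivWithinAt_pi.2 fun s => ?_
      have h2 := HasDerivWithinAt.fun_sum fun a (_ : a ∈ Finset.univ) =>
        ((((hasDerivWithinAt_id t J).mul_const (M.r s a)).sub (hℓ t ht s a)).const_mul (π₀ s a))
      refine h2.congr_deriv ?_
      have h3 : ∀ a, π₀ s a * (1 * M.r s a - (M.qValue (V t) s a - V t s)) =
          π₀ s a * V t s - M.γ * (π₀ s a * M.nextValue (V t) s a) := fun a => by
        rw [qValue]; ring
      rw [Finset.sum_congr rfl fun a _ => h3 a, Finset.sum_sub_distrib, ← Finset.sum_mul,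
        ← Finset.mul_sum, (hπ₀.1 s).2, one_mul]
    have h4 := B.hasFDerivAt.comp_hasDerivWithinAt t h1
    rwa [hB] at h4
  have hconst : ∀ t ∈ J, ∀ s a,
      ℓ t s a = t * M.r s a + M.γ * M.nextValue (W t) s a - W t s := by
    intro t ht s a
    have hder : ∀ u ∈ J, HasDerivWithinAt
        (fun u => ℓ u s a - (u * M.r s a + M.γ * M.nextValue (W u) s a - W u s)) 0 J u := by
      intro u hu
      have h1 := (hℓ u hu s a).sub ((((hasDerivWithinAt_id u J).mul_const (M.r s a)).add
        ((M.hasDerivWithinAt_nextValue (hW u hu) s a).const_mul M.γ)).sub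
        (hasDerivWithinAt_pi.1 (hW u hu) s))
      refine h1.congr_deriv ?_
      rw [qValue]; ring
    have h1 := hJ.norm_image_sub_le_of_norm_hasDerivWithin_le (C := 0) hder (fun u _ => by simp)
      h0 ht
    have hℓ0 : ∀ s a, ℓ 0 s a = 0 := fun s a => by simp [ℓ, hq0]
    have hW0 : W 0 = 0 := by
      simp only [W, hℓ0, zero_mul, sub_zero, mul_zero, Finset.sum_const_zero]
      exact map_zero B
    replace h1 := norm_le_zero_iff.1 (h1.trans_eq (zero_mul _))
    simp only [hℓ0, hW0, nextValue, Pi.zero_apply, zero_mul, mul_zero, Finset.sum_const_zero,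
      add_zero, sub_zero] at h1
    exact sub_eq_zero.1 h1
  intro t ht
  have hqt : q t = M.tiltedPolicy π₀ t (W t) := by
    funext s a
    rw [tiltedPolicy, ← hconst t ht s a, Real.exp_sub, Real.exp_log ((hq t ht).1.2 s a),
      Real.exp_log (hπ₀.2 s a), mul_div_cancel₀ _ (hπ₀.2 s a).ne']
  rw [softPolicy, ← M.eq_softValue_of_sum_tiltedPolicy hπ₀.1 (W := W t) fun s => by
    rw [← hqt]; exact ((hq t ht).1.1 s).2]
  exact hqt

end FiniteMDP

/-! ### The Kakade divergence -/

/-- The Kullback-Leibler divergence dominates the squared Hellinger distance. This quantitative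
form of Gibbs' inequality also survives limits in which entries of `q` tend to zero. -/
theorem sum_sqrt_sub_sqrt_sq_le_vecKL {A : Type*} [Fintype A] {p q : A → ℝ}
    (hp : p ∈ stdSimplex ℝ A) (hq : q ∈ stdSimplex ℝ A) (hq0 : ∀ a, 0 < q a) :
    ∑ a, (√(p a) - √(q a)) ^ 2 ≤ vecKL p q := by
  have h1 : ∀ a, 2 * p a - 2 * (√(p a) * √(q a)) ≤ p a * Real.log (p a / q a) := by
    intro a
    rcases (hp.1 a).eq_or_lt with h0 | h0
    · simp [← h0]
    have hlog : Real.log (√(q a / p a)) ≤ √(q a / p a) - 1 :=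
      Real.log_le_sub_one_of_pos (Real.sqrt_pos.2 (div_pos (hq0 a) h0))
    rw [Real.log_sqrt (div_pos (hq0 a) h0).le, ← inv_div (p a), Real.log_inv] at hlog
    have hsq : p a * √((p a / q a)⁻¹) = √(p a) * √(q a) := by
      rw [inv_div, Real.sqrt_div (hq0 a).le]
      nth_rewrite 1 [← Real.mul_self_sqrt h0.le]
      have := (Real.sqrt_pos.2 h0).ne'
      field_simp
    nlinarith [mul_le_mul_of_nonneg_left hlog h0.le]
  have h2 : ∀ a, (√(p a) - √(q a)) ^ 2 =
      (2 * p a - 2 * (√(p a) * √(q a))) + (q a - p a) := fun a => by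
    rw [sub_sq, Real.sq_sqrt (hp.1 a), Real.sq_sqrt (hq.1 a)]
    ring
  calc ∑ a, (√(p a) - √(q a)) ^ 2
      = ∑ a, (2 * p a - 2 * (√(p a) * √(q a))) + (∑ a, q a - ∑ a, p a) := by
        simp only [h2, Finset.sum_add_distrib, Finset.sum_sub_distrib]
    _ = ∑ a, (2 * p a - 2 * (√(p a) * √(q a))) := by rw [hp.2, hq.2, sub_self, add_zero]
    _ ≤ vecKL p q := Finset.sum_le_sum fun a _ => h1 a

theorem vecKL_self {A : Type*} [Fintype A] (p : A → ℝ) : vecKL p p = 0 := by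
  refine Finset.sum_eq_zero fun a _ => ?_
  rcases eq_or_ne (p a) 0 with h | h
  · simp [h]
  · simp [div_self h]

theorem continuous_vecKL {A : Type*} [Fintype A] {q : A → ℝ} (hq : ∀ a, 0 < q a) :
    Continuous fun p => vecKL p q := by
  have h : (fun p => vecKL p q) = fun p => ∑ a, (p a * Real.log (p a) - p a * Real.log (q a)) := by
    funext p
    refine Finset.sum_congr rfl fun a _ => ?_
    rcases eq_or_ne (p a) 0 with h0 | h0
    · simp [h0]
    · rw [Real.log_div h0 (hq a).ne', mul_sub]
  rw [h]
  exact continuous_finsetSum _ fun a _ =>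
    (Real.continuous_mul_log.comp (continuous_apply a)).sub (by fun_prop)

theorem eq_of_sum_sqrt_sub_sqrt_sq_eq_zero {A : Type*} [Fintype A] {p q : A → ℝ}
    (hp : ∀ a, 0 ≤ p a) (hq : ∀ a, 0 ≤ q a) (h : ∑ a, (√(p a) - √(q a)) ^ 2 = 0) : p = q := by
  funext a
  have h1 := (Finset.sum_eq_zero_iff_of_nonneg fun a _ => sq_nonneg _).1 h a (Finset.mem_univ a)
  exact (Real.sqrt_inj (hp a) (hq a)).1 (sub_eq_zero.1 (pow_eq_zero_iff two_ne_zero |>.1 h1))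

namespace FiniteMDP

variable {S A : Type*} [Fintype S] [Fintype A] [MeasurableSpace S] [MeasurableSingletonClass S]
  [MeasurableSpace A] [MeasurableSingletonClass A]

/-- The state-averaged squared Hellinger distance, a lower bound of the Kakade divergence that is
continuous up to the boundary in both arguments. -/
noncomputable def hellingerDist (M : FiniteMDP S A) (π ρ : S → A → ℝ) : ℝ :=
  ∑ s, M.stateDist π s * ∑ a, (√(π s a) - √(ρ s a)) ^ 2

theorem hellingerDist_nonneg (M : FiniteMDP S A) (π ρ : S → A → ℝ) : 0 ≤ M.hellingerDist π ρ :=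
  Finset.sum_nonneg fun s _ => mul_nonneg (M.stateDist_nonneg π s)
    (Finset.sum_nonneg fun _ _ => sq_nonneg _)

theorem eq_of_hellingerDist_nonpos (M : FiniteMDP S A) {π ρ : S → A → ℝ}
    (hπ : π ∈ policies S A) (hρ : ρ ∈ policies S A) (h : M.hellingerDist π ρ ≤ 0) {s : S}
    (hs : 0 < M.stateDist π s) : π s = ρ s := by
  have h1 := (Finset.sum_eq_zero_iff_of_nonneg fun s _ => mul_nonneg (M.stateDist_nonneg π s)
    (Finset.sum_nonneg fun _ _ => sq_nonneg _)).1 (h.antisymm (M.hellingerDist_nonneg π ρ)) s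
    (Finset.mem_univ s)
  exact eq_of_sum_sqrt_sub_sqrt_sq_eq_zero (hπ s).1 (hρ s).1
    ((mul_eq_zero.1 h1).resolve_left hs.ne')

theorem hellingerDist_le_kakadeDiv (M : FiniteMDP S A) {π ρ : S → A → ℝ}
    (hπ : π ∈ policies S A) (hρ : ρ ∈ interiorPolicies S A) :
    M.hellingerDist π ρ ≤ M.kakadeDiv π ρ :=
  Finset.sum_le_sum fun s _ => mul_le_mul_of_nonneg_left
    (sum_sqrt_sub_sqrt_sq_le_vecKL (hπ s) (hρ.1 s) (hρ.2 s)) (M.stateDist_nonneg π s)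

theorem kakadeDiv_nonneg (M : FiniteMDP S A) {π ρ : S → A → ℝ}
    (hπ : π ∈ policies S A) (hρ : ρ ∈ interiorPolicies S A) : 0 ≤ M.kakadeDiv π ρ :=
  (M.hellingerDist_nonneg π ρ).trans (M.hellingerDist_le_kakadeDiv hπ hρ)

theorem kakadeDiv_self (M : FiniteMDP S A) (π : S → A → ℝ) : M.kakadeDiv π π = 0 := by
  simp [kakadeDiv, vecKL_self]

/-- Under state exploration the Kakade divergence separates policies, although the state
distribution of the first argument may vanish somewhere. -/
theorem eq_of_kakadeDiv_nonpos (M : FiniteMDP S A) (hM : M.Exploration) {π ρ : S → A → ℝ}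
    (hπ : π ∈ policies S A) (hρ : ρ ∈ interiorPolicies S A) (h : M.kakadeDiv π ρ ≤ 0) : π = ρ := by
  have h1 : ∀ s, 0 < M.stateDist π s → π s = ρ s := fun s =>
    M.eq_of_hellingerDist_nonpos hπ hρ.1 ((M.hellingerDist_le_kakadeDiv hπ hρ).trans h)
  have h2 := M.stateDist_eq_of_eq hπ hρ.1 h1
  exact funext fun s => h1 s (h2 ▸ hM ρ hρ s)

theorem continuousOn_kakadeDiv (M : FiniteMDP S A) {ρ : S → A → ℝ}
    (hρ : ρ ∈ interiorPolicies S A) :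
    ContinuousOn (fun π => M.kakadeDiv π ρ) (policies S A) :=
  continuousOn_finsetSum _ fun s _ => (M.continuousOn_stateDist s).mul
    ((continuous_vecKL (hρ.2 s)).comp (continuous_apply s)).continuousOn

/-- The three-point identity: up to a constant, the regularized reward of `π` is minus its
divergence from the point of the central path. -/
theorem reward_sub_kakadeDiv (M : FiniteMDP S A) {π₀ : S → A → ℝ}
    (hπ₀ : π₀ ∈ interiorPolicies S A) (t : ℝ) {π : S → A → ℝ} (hπ : π ∈ policies S A) :
    t * M.reward π - M.kakadeDiv π π₀ =
      (1 - M.γ) * ∑ s, M.μ s * M.softValue hπ₀.1 t s -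
        M.kakadeDiv π (M.softPolicy hπ₀.1 t) := by
  set W := M.softValue hπ₀.1 t with hW
  have hKL : ∀ s, vecKL (π s) (π₀ s) = vecKL (π s) (M.softPolicy hπ₀.1 t s) +
      (t * ∑ a, π s a * M.r s a + M.γ * ∑ a, π s a * M.nextValue W s a - W s) := by
    intro s
    have h1 : ∀ a, π s a * Real.log (π s a / π₀ s a) =
        π s a * Real.log (π s a / M.softPolicy hπ₀.1 t s a) +
          (t * (π s a * M.r s a) + M.γ * (π s a * M.nextValue W s a) - π s a * W s) := by
      intro a
      rcases eq_or_ne (π s a) 0 with h0 | h0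
      · simp [h0]
      have h2 : Real.log (M.softPolicy hπ₀.1 t s a) = Real.log (π₀ s a) +
          (t * M.r s a + M.γ * M.nextValue W s a - W s) := by
        rw [softPolicy, tiltedPolicy, Real.log_mul (hπ₀.2 s a).ne' (Real.exp_pos _).ne',
          Real.log_exp]
      rw [Real.log_div h0 (hπ₀.2 s a).ne',
        Real.log_div h0 ((M.softPolicy_mem hπ₀ t).2 s a).ne', h2]
      ring
    simp only [vecKL, h1, Finset.sum_add_distrib, Finset.sum_sub_distrib, ← Finset.mul_sum,
      ← Finset.sum_mul, (hπ s).2, one_mul]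
  have hD : M.kakadeDiv π π₀ = M.kakadeDiv π (M.softPolicy hπ₀.1 t) + (t * M.reward π +
      M.γ * ∑ s, M.stateDist π s * ∑ a, π s a * M.nextValue W s a -
        ∑ s, M.stateDist π s * W s) := by
    rw [M.reward_eq hπ, Finset.mul_sum, Finset.mul_sum, ← Finset.sum_add_distrib,
      ← Finset.sum_sub_distrib, kakadeDiv, kakadeDiv, ← Finset.sum_add_distrib]
    refine Finset.sum_congr rfl fun s _ => ?_
    rw [hKL s]
    ring
  rw [hD, M.sum_stateDist_mul hπ W]
  ring

/-- The Pythagorean identity on the central path. -/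
theorem kakadeDiv_eq_add (M : FiniteMDP S A) {π₀ : S → A → ℝ}
    (hπ₀ : π₀ ∈ interiorPolicies S A) (t : ℝ) {π : S → A → ℝ} (hπ : π ∈ policies S A) :
    M.kakadeDiv π π₀ = t * (M.reward π - M.reward (M.softPolicy hπ₀.1 t)) +
      M.kakadeDiv (M.softPolicy hπ₀.1 t) π₀ + M.kakadeDiv π (M.softPolicy hπ₀.1 t) := by
  have h1 := M.reward_sub_kakadeDiv hπ₀ t hπ
  have h2 := M.reward_sub_kakadeDiv hπ₀ t (M.softPolicy_mem hπ₀ t).1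
  rw [kakadeDiv_self] at h2
  linarith

/-! ### The central path property -/

theorem setOf_isMaxOn_regularized (M : FiniteMDP S A) (hM : M.Exploration) {π₀ : S → A → ℝ}
    (hπ₀ : π₀ ∈ interiorPolicies S A) {t : ℝ} (ht : 0 < t) :
    {π | π ∈ policies S A ∧
      IsMaxOn (fun ρ => M.reward ρ - t⁻¹ * M.kakadeDiv ρ π₀) (policies S A) π} =
      {M.softPolicy hπ₀.1 t} := by
  have hp := M.softPolicy_mem hπ₀ t
  have hf : ∀ ρ ∈ policies S A, M.reward ρ - t⁻¹ * M.kakadeDiv ρ π₀ =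
      t⁻¹ * ((1 - M.γ) * ∑ s, M.μ s * M.softValue hπ₀.1 t s -
        M.kakadeDiv ρ (M.softPolicy hπ₀.1 t)) := fun ρ hρ => by
    rw [← M.reward_sub_kakadeDiv hπ₀ t hρ, mul_sub, inv_mul_cancel_left₀ ht.ne']
  ext π
  refine ⟨fun ⟨hπ, hmax⟩ => M.eq_of_kakadeDiv_nonpos hM hπ hp ?_, fun h => ?_⟩
  · have h1 := isMaxOn_iff.1 hmax _ hp.1
    rw [hf _ hp.1, hf _ hπ, kakadeDiv_self] at h1
    have h2 := le_of_mul_le_mul_left h1 (inv_pos.2 ht)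
    linarith
  · rw [Set.mem_singleton_iff.1 h]
    refine ⟨hp.1, isMaxOn_iff.2 fun ρ hρ => ?_⟩
    rw [hf _ hp.1, hf _ hρ, kakadeDiv_self]
    have := M.kakadeDiv_nonneg hρ hp
    exact mul_le_mul_of_nonneg_left (by linarith) (inv_pos.2 ht).le

theorem setOf_isMinOn_kakadeDiv (M : FiniteMDP S A) (hM : M.Exploration) {π₀ : S → A → ℝ}
    (hπ₀ : π₀ ∈ interiorPolicies S A) :
    {π | π ∈ policies S A ∧ IsMinOn (fun ρ => M.kakadeDiv ρ π₀) (policies S A) π} = {π₀} := by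
  ext π
  refine ⟨fun ⟨hπ, hmin⟩ => M.eq_of_kakadeDiv_nonpos hM hπ hπ₀ ?_, fun h => ?_⟩
  · have h1 := isMinOn_iff.1 hmin _ hπ₀.1
    rwa [kakadeDiv_self] at h1
  · rw [Set.mem_singleton_iff.1 h]
    refine ⟨hπ₀.1, isMinOn_iff.2 fun ρ hρ => ?_⟩
    rw [kakadeDiv_self]
    exact M.kakadeDiv_nonneg hρ hπ₀

/-! ### Optimal policies and Kakade projections -/

theorem isGreatest_optReward (M : FiniteMDP S A) (hne : (policies S A).Nonempty) :
    IsGreatest (M.reward '' policies S A) M.optReward :=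
  ((isCompact_policies S A).image_of_continuousOn M.continuousOn_reward).isGreatest_sSup
    (hne.image _)

theorem reward_le_optReward (M : FiniteMDP S A) {π : S → A → ℝ} (hπ : π ∈ policies S A) :
    M.reward π ≤ M.optReward :=
  (M.isGreatest_optReward ⟨π, hπ⟩).2 ⟨π, hπ, rfl⟩

theorem isLeast_minKakadeDiv (M : FiniteMDP S A) {π₀ : S → A → ℝ}
    (hπ₀ : π₀ ∈ interiorPolicies S A) :
    IsLeast ((fun ρ => M.kakadeDiv ρ π₀) '' M.optPolicies) (M.minKakadeDiv π₀) := by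
  obtain ⟨π, hπ, hopt⟩ := (M.isGreatest_optReward ⟨π₀, hπ₀.1⟩).1
  have hclosed : IsClosed M.optPolicies :=
    M.continuousOn_reward.preimage_isClosed_of_isClosed (isCompact_policies S A).isClosed
      (isClosed_singleton (x := M.optReward))
  have hcomp : IsCompact M.optPolicies :=
    (isCompact_policies S A).of_isClosed_subset hclosed fun _ h => h.1
  exact (hcomp.image_of_continuousOn ((M.continuousOn_kakadeDiv hπ₀).mono fun _ h =>
    h.1)).isLeast_sInf (Set.Nonempty.image _ ⟨π, hπ, hopt⟩)

theorem mem_kakadeProjections_iff (M : FiniteMDP S A) {π₀ : S → A → ℝ}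
    (hπ₀ : π₀ ∈ interiorPolicies S A) {π : S → A → ℝ} :
    π ∈ M.kakadeProjections π₀ ↔
      π ∈ M.optPolicies ∧ M.kakadeDiv π π₀ ≤ M.minKakadeDiv π₀ := by
  obtain ⟨⟨ρ, hρ, hρmin⟩, hlow⟩ := M.isLeast_minKakadeDiv hπ₀
  refine ⟨fun h => ⟨h.1, hρmin ▸ isMinOn_iff.1 h.2 ρ hρ⟩, fun h =>
    ⟨h.1, isMinOn_iff.2 fun σ hσ => ?_⟩⟩
  exact h.2.trans (hlow ⟨σ, hσ, rfl⟩)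

theorem kakadeDiv_of_mem_kakadeProjections (M : FiniteMDP S A) {π₀ : S → A → ℝ}
    (hπ₀ : π₀ ∈ interiorPolicies S A) {π : S → A → ℝ} (hπ : π ∈ M.kakadeProjections π₀) :
    M.kakadeDiv π π₀ = M.minKakadeDiv π₀ :=
  ((M.mem_kakadeProjections_iff hπ₀).1 hπ).2.antisymm
    ((M.isLeast_minKakadeDiv hπ₀).2 ⟨π, hπ.1, rfl⟩)

theorem kakadeProjections_nonempty (M : FiniteMDP S A) {π₀ : S → A → ℝ}
    (hπ₀ : π₀ ∈ interiorPolicies S A) : (M.kakadeProjections π₀).Nonempty := by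
  obtain ⟨ρ, hρ, hρmin⟩ := (M.isLeast_minKakadeDiv hπ₀).1
  exact ⟨ρ, (M.mem_kakadeProjections_iff hπ₀).2 ⟨hρ, hρmin.le⟩⟩

/-- The Pythagorean identity for the projections of `π₀` onto the set of optimal policies. -/
theorem minKakadeDiv_eq_add (M : FiniteMDP S A) {π₀ : S → A → ℝ}
    (hπ₀ : π₀ ∈ interiorPolicies S A) (t : ℝ) {π : S → A → ℝ} (hπ : π ∈ M.kakadeProjections π₀) :
    M.minKakadeDiv π₀ = t * (M.optReward - M.reward (M.softPolicy hπ₀.1 t)) +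
      M.kakadeDiv (M.softPolicy hπ₀.1 t) π₀ + M.kakadeDiv π (M.softPolicy hπ₀.1 t) := by
  rw [← M.kakadeDiv_of_mem_kakadeProjections hπ₀ hπ, M.kakadeDiv_eq_add hπ₀ t hπ.1.1, hπ.1.2]

theorem optReward_sub_reward_le (M : FiniteMDP S A) {π₀ : S → A → ℝ}
    (hπ₀ : π₀ ∈ interiorPolicies S A) {t : ℝ} (ht : 0 < t) :
    M.optReward - M.reward (M.softPolicy hπ₀.1 t) ≤
      (M.minKakadeDiv π₀ - M.kakadeDiv (M.softPolicy hπ₀.1 t) π₀) / t := by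
  obtain ⟨π, hπ⟩ := M.kakadeProjections_nonempty hπ₀
  have h1 := M.minKakadeDiv_eq_add hπ₀ t hπ
  have h2 := M.kakadeDiv_nonneg hπ.1.1 (M.softPolicy_mem hπ₀ t)
  rw [le_div_iff₀ ht]
  linarith

/-! ### The limit of the flow -/

/-- Every cluster point of the central path at infinity is a Kakade projection, and every Kakade
projection agrees with it in the states that the projection visits: by the Pythagorean identity
the divergence of the projection from the central path tends to zero. -/
theorem mem_kakadeProjections_of_tendsto (M : FiniteMDP S A) {π₀ : S → A → ℝ}
    (hπ₀ : π₀ ∈ interiorPolicies S A) {F : Filter ℝ} [F.NeBot] (hF : F ≤ atTop)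
    {πs : S → A → ℝ} (hlim : Tendsto (M.softPolicy hπ₀.1) F (𝓝 πs)) :
    πs ∈ M.kakadeProjections π₀ ∧
      ∀ π ∈ M.kakadeProjections π₀, ∀ s, 0 < M.stateDist π s → π s = πs s := by
  have hmem : ∀ t, M.softPolicy hπ₀.1 t ∈ policies S A := fun t => (M.softPolicy_mem hπ₀ t).1
  have hπs : πs ∈ policies S A :=
    (isCompact_policies S A).isClosed.mem_of_tendsto hlim (Eventually.of_forall hmem)
  have hlim' : Tendsto (M.softPolicy hπ₀.1) F (𝓝[policies S A] πs) :=
    tendsto_nhdsWithin_iff.2 ⟨hlim, Eventually.of_forall hmem⟩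
  have hR := (M.continuousOn_reward πs hπs).tendsto.comp hlim'
  have hD := (M.continuousOn_kakadeDiv hπ₀ πs hπs).tendsto.comp hlim'
  have hpos : ∀ᶠ t : ℝ in F, 0 < t := hF (eventually_gt_atTop 0)
  have hgap : ∀ t, 0 ≤ M.optReward - M.reward (M.softPolicy hπ₀.1 t) := fun t =>
    sub_nonneg.2 (M.reward_le_optReward (hmem t))
  have hopt : M.reward πs = M.optReward := by
    refine (M.reward_le_optReward hπs).antisymm ?_
    have h0 : Tendsto (fun t => M.minKakadeDiv π₀ / t) F (𝓝 0) :=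
      (tendsto_const_nhds.div_atTop tendsto_id).mono_left hF
    refine sub_nonpos.1 (le_of_tendsto_of_tendsto (hR.const_sub M.optReward) h0 ?_)
    filter_upwards [hpos] with t ht
    refine (M.optReward_sub_reward_le hπ₀ ht).trans ?_
    exact div_le_div_of_nonneg_right
      (sub_le_self _ (M.kakadeDiv_nonneg (hmem t) hπ₀)) ht.le
  have hHle : ∀ π ∈ M.kakadeProjections π₀, ∀ᶠ t in F,
      M.hellingerDist π (M.softPolicy hπ₀.1 t) ≤
        M.minKakadeDiv π₀ - M.kakadeDiv (M.softPolicy hπ₀.1 t) π₀ := by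
    intro π hπ
    filter_upwards [hpos] with t ht
    have h1 := M.minKakadeDiv_eq_add hπ₀ t hπ
    have h2 := M.hellingerDist_le_kakadeDiv hπ.1.1 (M.softPolicy_mem hπ₀ t)
    have h3 := mul_nonneg ht.le (hgap t)
    linarith
  have hproj : πs ∈ M.kakadeProjections π₀ := by
    refine (M.mem_kakadeProjections_iff hπ₀).2 ⟨⟨hπs, hopt⟩, le_of_tendsto hD ?_⟩
    obtain ⟨π, hπ⟩ := M.kakadeProjections_nonempty hπ₀
    filter_upwards [hHle π hπ] with t ht
    have := M.hellingerDist_nonneg π (M.softPolicy hπ₀.1 t)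
    exact sub_nonneg.1 (this.trans ht)
  refine ⟨hproj, fun π hπ s => M.eq_of_hellingerDist_nonpos hπ.1.1 hπs ?_⟩
  have hH : Tendsto (fun t => M.hellingerDist π (M.softPolicy hπ₀.1 t)) F
      (𝓝 (M.hellingerDist π πs)) := by
    have hcont : Continuous fun ρ => M.hellingerDist π ρ := by
      unfold hellingerDist
      fun_prop
    exact (hcont.tendsto πs).comp hlim
  refine (le_of_tendsto_of_tendsto hH (hD.const_sub (M.minKakadeDiv π₀)) (hHle π hπ)).trans_eq ?_
  exact sub_eq_zero.2 (M.kakadeDiv_of_mem_kakadeProjections hπ₀ hproj).symm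

theorem stateDist_pos_of_μ_pos (M : FiniteMDP S A) {π : S → A → ℝ} (hπ : π ∈ policies S A) {s : S}
    (hs : 0 < M.μ s) : 0 < M.stateDist π s := by
  rw [M.stateDist_balance hπ s]
  refine add_pos_of_pos_of_nonneg (mul_pos (sub_pos.2 M.γ_lt_one) hs)
    (mul_nonneg M.γ_nonneg (Finset.sum_nonneg fun s' _ => mul_nonneg (M.stateDist_nonneg π s')
      (Finset.sum_nonneg fun a _ => mul_nonneg ((hπ s').1 a) ((M.P_mem s' a).1 s))))

theorem exists_tendsto_softPolicy_of_μ_pos (M : FiniteMDP S A) (hμ : ∀ s, 0 < M.μ s)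
    {π₀ : S → A → ℝ} (hπ₀ : π₀ ∈ interiorPolicies S A) :
    ∃ πs, Tendsto (M.softPolicy hπ₀.1) atTop (𝓝 πs) := by
  obtain ⟨π, hπ⟩ := M.kakadeProjections_nonempty hπ₀
  refine ⟨π, (isCompact_policies S A).tendsto_nhds_of_unique_mapClusterPt
    (Eventually.of_forall fun t => (M.softPolicy_mem hπ₀ t).1) fun ρ _ hρ => ?_⟩
  obtain ⟨U, hU, hlim⟩ := mapClusterPt_iff_ultrafilter.1 hρ
  exact funext fun s => ((M.mem_kakadeProjections_of_tendsto hπ₀ hU hlim).2 π hπ s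
    (M.stateDist_pos_of_μ_pos hπ.1.1 (hμ s))).symm

/-- The central path converges. It does not depend on the initial distribution, so that this may
be taken uniform, and then the Kakade projection is unique. -/
theorem exists_tendsto_softPolicy (M : FiniteMDP S A) {π₀ : S → A → ℝ}
    (hπ₀ : π₀ ∈ interiorPolicies S A) :
    ∃ πs, Tendsto (M.softPolicy hπ₀.1) atTop (𝓝 πs) := by
  have hcard : 0 < (Fintype.card S : ℝ) := by
    rcases isEmpty_or_nonempty S with h | h
    · have := M.μ_mem.2
      simp at this
    · exact_mod_cast Fintype.card_pos
  let M' : FiniteMDP S A :=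
    { M with
      μ := fun _ => (Fintype.card S : ℝ)⁻¹
      μ_mem := ⟨fun _ => (inv_pos.2 hcard).le, by simp [hcard.ne']⟩ }
  exact M'.exists_tendsto_softPolicy_of_μ_pos (fun _ => inv_pos.2 hcard) hπ₀

/-! ### Policies with the same state-action distribution -/

theorem sum_stateActionDist (M : FiniteMDP S A) {π : S → A → ℝ} (hπ : π ∈ policies S A) (s : S) :
    ∑ a, M.stateActionDist π s a = M.stateDist π s := by
  simp only [M.stateActionDist_eq hπ, ← Finset.mul_sum, (hπ s).2, mul_one]

/-- Two policies have the same state-action distribution if and only if they agree in the states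
that they visit. -/
theorem stateActionDist_eq_iff (M : FiniteMDP S A) {π ρ : S → A → ℝ} (hπ : π ∈ policies S A)
    (hρ : ρ ∈ policies S A) : M.stateActionDist π = M.stateActionDist ρ ↔
      ∀ s, 0 < M.stateDist π s → π s = ρ s := by
  refine ⟨fun h s hs => funext fun a => ?_, fun h => ?_⟩
  · have hd : M.stateDist π s = M.stateDist ρ s := by
      rw [← M.sum_stateActionDist hπ, ← M.sum_stateActionDist hρ, h]
    have h1 := congrFun (congrFun h s) a
    rw [M.stateActionDist_eq hπ, M.stateActionDist_eq hρ, ← hd] at h1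
    exact mul_left_cancel₀ hs.ne' h1
  · have hd := M.stateDist_eq_of_eq hπ hρ h
    funext s a
    rw [M.stateActionDist_eq hπ, M.stateActionDist_eq hρ, ← hd]
    rcases (M.stateDist_nonneg π s).eq_or_lt with h0 | h0
    · simp [← h0]
    · rw [h s h0]

/-- The set of Kakade projections is one fibre of the map `π ↦ ν^π`: the reward and the Kakade
divergence factor through this map, and any projection agrees with the limit of the flow in the
states that it visits. -/
theorem kakadeProjections_eq (M : FiniteMDP S A) {π₀ πs : S → A → ℝ}
    (hπ₀ : π₀ ∈ interiorPolicies S A)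
    (hlim : Tendsto (M.softPolicy hπ₀.1) atTop (𝓝 πs)) :
    M.kakadeProjections π₀ =
      {π | π ∈ policies S A ∧ M.stateActionDist π = M.stateActionDist πs} := by
  obtain ⟨hπs, hagree⟩ := M.mem_kakadeProjections_of_tendsto hπ₀ le_rfl hlim
  ext π
  refine ⟨fun h => ⟨h.1.1, (M.stateActionDist_eq_iff h.1.1 hπs.1.1).2 (hagree π h)⟩,
    fun ⟨hπ, hν⟩ => ?_⟩
  have h1 := (M.stateActionDist_eq_iff hπ hπs.1.1).1 hν
  have hd := M.stateDist_eq_of_eq hπ hπs.1.1 h1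
  have hsum : ∀ f : (A → ℝ) → S → ℝ,
      ∑ s, M.stateDist π s * f (π s) s = ∑ s, M.stateDist πs s * f (πs s) s := fun f => by
    refine Finset.sum_congr rfl fun s _ => ?_
    rw [← hd]
    rcases (M.stateDist_nonneg π s).eq_or_lt with h0 | h0
    · simp [← h0]
    · rw [h1 s h0]
  have hR : M.reward π = M.reward πs := by
    rw [M.reward_eq hπ, M.reward_eq hπs.1.1]
    exact hsum fun p s => ∑ a, p a * M.r s a
  have hD : M.kakadeDiv π π₀ = M.kakadeDiv πs π₀ := hsum fun p s => vecKL p (π₀ s)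
  rw [M.mem_kakadeProjections_iff hπ₀] at hπs ⊢
  exact ⟨⟨hπ, hR.trans hπs.1.2⟩, hD.trans_le hπs.2⟩

end FiniteMDP

theorem theorem3p6 {S A : Type*} [Fintype S] [Fintype A]
    [MeasurableSpace S] [MeasurableSingletonClass S]
    [MeasurableSpace A] [MeasurableSingletonClass A]
    (M : FiniteMDP S A) (hM : M.Exploration)
    (π₀ : S → A → ℝ) (hπ₀ : π₀ ∈ interiorPolicies S A) :
    ∃ p : ℝ → S → A → ℝ,
      -- well-posedness: a global solution exists, and it is unique (also locally in time)
      (M.IsKakadeFlowOn (Set.Ici 0) p ∧ p 0 = π₀ ∧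
        (∀ q : ℝ → S → A → ℝ, M.IsKakadeFlowOn (Set.Ici 0) q → q 0 = π₀ →
          Set.EqOn q p (Set.Ici 0)) ∧
        (∀ T : ℝ, 0 < T → ∀ q : ℝ → S → A → ℝ, M.IsKakadeFlowOn (Set.Ico 0 T) q → q 0 = π₀ →
          Set.EqOn q p (Set.Ico 0 T))) ∧
      -- central path property (at `t = 0` only the divergence term is left)
      ((∀ t : ℝ, 0 < t →
          {π | π ∈ policies S A ∧
            IsMaxOn (fun ρ => M.reward ρ - t⁻¹ * M.kakadeDiv ρ π₀) (policies S A) π} = {p t}) ∧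
        {π | π ∈ policies S A ∧
          IsMinOn (fun ρ => M.kakadeDiv ρ π₀) (policies S A) π} = {p 0}) ∧
      -- sublinear convergence; the maximum and the minimum in it are attained
      (IsGreatest (M.reward '' policies S A) M.optReward ∧
        IsLeast ((fun ρ => M.kakadeDiv ρ π₀) '' M.optPolicies) (M.minKakadeDiv π₀) ∧
        (∀ t : ℝ, 0 ≤ t → 0 ≤ M.optReward - M.reward (p t)) ∧
        ∀ t : ℝ, 0 < t →
          M.optReward - M.reward (p t) ≤
              (M.minKakadeDiv π₀ - M.kakadeDiv (p t) π₀) / t ∧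
            (M.minKakadeDiv π₀ - M.kakadeDiv (p t) π₀) / t ≤ M.minKakadeDiv π₀ / t) ∧
      -- implicit bias: the flow converges to a Kakade projection of `π₀` onto `Π⋆`, which is unique
      -- up to the actions in states that it never visits
      ∃ πs : S → A → ℝ, Tendsto p atTop (𝓝 πs) ∧
        πs ∈ M.kakadeProjections π₀ ∧
        M.kakadeProjections π₀ =
          {π | π ∈ policies S A ∧ M.stateActionDist π = M.stateActionDist πs} ∧
        (∀ π ∈ M.kakadeProjections π₀, ∀ s, 0 < M.stateDist πs s → π s = πs s) ∧
        ((∀ s, 0 < M.stateDist πs s) → M.kakadeProjections π₀ = {πs}) := by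
  have hunique : ∀ J : Set ℝ, Convex ℝ J → 0 ∈ J → ∀ q : ℝ → S → A → ℝ, M.IsKakadeFlowOn J q →
      q 0 = π₀ → Set.EqOn q (M.softPolicy hπ₀.1) J := fun J hJ h0 q hq hq0 =>
    FiniteMDP.IsKakadeFlowOn.eqOn_softPolicy hM hπ₀ hJ h0 hq hq0
  have hmem : ∀ t, M.softPolicy hπ₀.1 t ∈ policies S A := fun t => (M.softPolicy_mem hπ₀ t).1
  obtain ⟨πs, hlim⟩ := M.exists_tendsto_softPolicy hπ₀
  have hπs := (M.mem_kakadeProjections_of_tendsto hπ₀ le_rfl hlim).1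
  have hproj := M.kakadeProjections_eq hπ₀ hlim
  have hvisited : ∀ π ∈ M.kakadeProjections π₀, ∀ s, 0 < M.stateDist πs s → π s = πs s := by
    intro π hπ s hs
    have hν := hπ
    rw [hproj] at hν
    exact ((M.stateActionDist_eq_iff hπs.1.1 hπ.1.1).1 hν.2.symm s hs).symm
  refine ⟨M.softPolicy hπ₀.1, ⟨M.isKakadeFlowOn_softPolicy hM hπ₀ _, M.softPolicy_zero hπ₀.1,
    hunique _ (convex_Ici 0) Set.self_mem_Ici, fun T hT =>
      hunique _ (convex_Ico 0 T) (Set.left_mem_Ico.2 hT)⟩,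
    ⟨fun t ht => M.setOf_isMaxOn_regularized hM hπ₀ ht, ?_⟩,
    ⟨M.isGreatest_optReward ⟨π₀, hπ₀.1⟩, M.isLeast_minKakadeDiv hπ₀,
      fun t _ => sub_nonneg.2 (M.reward_le_optReward (hmem t)),
      fun t ht => ⟨M.optReward_sub_reward_le hπ₀ ht, ?_⟩⟩,
    πs, hlim, hπs, hproj, hvisited, fun hpos => ?_⟩
  · rw [M.softPolicy_zero]
    exact M.setOf_isMinOn_kakadeDiv hM hπ₀
  · exact div_le_div_of_nonneg_right (sub_le_self _ (M.kakadeDiv_nonneg (hmem t) hπ₀)) ht.le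
  · exact Set.eq_singleton_iff_unique_mem.2
      ⟨hπs, fun π hπ => funext fun s => hvisited π hπ s (hpos s)⟩
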